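/- Let $\Psi:\mathbb R^d\to\mathbb R^d$ be of one of two types. (i) Component-wise: $\Psi(x)=[\psi(x_1),\dots,\psi(x_d)]^\top$, with $\psi:\mathbb R\to\mathbb R$ twice continuously differentiable, non-decreasing, odd, strictly increasing on $(-c,c)$ for some $c>0$, and with $\psi,\psi',\psi''$ uniformly bounded. (ii) Joint: $\Psi(x)=x\,\varphi(\|x\|)$, with $\varphi:\mathbb R\to\mathbb R$ continuous except at finitely many points, positive and non-increasing on $(0,\infty)$, $s\mapsto s\varphi(s)$ non-decreasing on $(0,\infty)$, and $\Psi$ uniformly bounded. Let $C>0$ satisfy $\|\Psi(v)\|\le C$ for all $v$. For every $x\in\mathbb R^d$ let $P_x$ be a probability density on $\mathbb R^d$ (jointly measurable in $(x,z)$) with $P_x(-z)=P_x(z)$ for all $z$, and suppose that for some $E_0>0$, $\inf_{x}P_x(z)>0$ for all $\|z\|\le E_0$. If $d=1$ and $\Psi$ is not component-wise in the sense of (i), suppose moreover that $\inf_{x\in\mathbb R,\,|z|\le E_0}P_x(z)>0$ for some $E_0>0$. Put $\Phi_x(y)=\int\Psi(y+z)P_x(z)\,dz$. Then there are constants $\beta_1,\beta_2>0$,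 depending only on $\Psi$ and $(P_x)_x$, such that $$\langle\Phi_x(y),y\rangle\ge\min\{\beta_1\|y\|,\beta_2\|y\|^2\}\qquad\text{for all }x,y\in\mathbb R^d,\tag{1}$$ and for all $\beta_1,\beta_2>0$ that satisfy (1) the following holds. Let $F:\mathbb R^d\to\mathbb R$ be bounded from below and differentiable, with $L$-Lipschitz gradient. Let $x^1\in\mathbb R^d$ be deterministic and $$x^{t+1}=x^t-\alpha_t\Psi(\nabla f(x^t;\xi^t)),\qquad \alpha_t=\frac{a}{(t+1)^{\eta}},\qquad t=1,2,\dots,$$ with $\eta\in[1/2,1)$, where the noise $z^t=\nabla f(x^t;\xi^t)-\nabla F(x^t)$ has, conditionally on $x^1,\dots,x^t$, the density $P_{x^t}$, for every $t\ge1$. Let $\Delta=F(x^1)-\inf F$, $\widetilde\nabla=\|\nabla F(x^1)\|$ and $$0<a\le\min\Big\{1,\ \frac{\beta_2}{8C^2},\ \frac{(1-\eta)\beta_1}{8C^2\,(LC+(1-\eta)\widetilde\nabla)}\Big\}$$ (the last bound is void if its denominator is zero). Then there is a constant $M>0$ which does not depend on $t$ or $\delta$, and which depends on the problem only through $\Psi,(P_x)_x,\beta_1,\beta_2,C,L,\Delta,\widetilde\nabla,a,\eta$,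 such that for every integer $t\ge1$ and every $\delta\in(0,1)$, with probability at least $1-\delta$, $$\min_{1\le k\le t}\|\nabla F(x^k)\|^2\le M\,t^{\eta-1}\Big(\log(1/\delta)+\sum_{k=1}^t(k+1)^{-2\eta}\Big).$$ -/

import Mathlib

open MeasureTheory

noncomputable section

namespace NSGD

/-- The Euclidean space `ℝ^d`. -/
abbrev Vec (d : ℕ) : Type := EuclideanSpace ℝ (Fin d)

/-- The population cost is bounded from below and differentiable, with an `L`-Lipschitz gradient. -/
structure SmoothCost {d : ℕ} (F : Vec d → ℝ) (L : ℝ) : Prop where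
  bddBelow : BddBelow (Set.range F)
  differentiable : Differentiable ℝ F
  lipschitz : ∀ x y : Vec d, ‖gradient F x - gradient F y‖ ≤ L * ‖x - y‖

/-- `Ψ` is a smooth component-wise nonlinearity `Ψ(x) = [ψ(x₁), …, ψ(x_d)]`: `ψ` is `C²` (so it is
continuous and differentiable everywhere), non-decreasing, odd, strictly increasing near zero, and
`ψ`, `ψ'`, `ψ''` are uniformly bounded. -/
def IsComponentwise {d : ℕ} (Ψ : Vec d → Vec d) : Prop :=
  ∃ ψ : ℝ → ℝ,
    (∀ (x : Vec d) (i : Fin d), Ψ x i = ψ (x i)) ∧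
    ContDiff ℝ 2 ψ ∧ Monotone ψ ∧ (∀ s, ψ (-s) = -ψ s) ∧
    (∃ c > 0, StrictMonoOn ψ (Set.Ioo (-c) c)) ∧
    (∃ C₁ > 0, ∀ s, |ψ s| ≤ C₁) ∧
    (∃ K₁ > 0, ∀ s, |deriv ψ s| ≤ K₁) ∧
    (∃ K₂ > 0, ∀ s, |iteratedDeriv 2 ψ s| ≤ K₂)

/-- `Ψ` is a joint nonlinearity `Ψ(x) = x φ(‖x‖)`: `φ` is continuous except at finitely many points,
positive and non-increasing on `(0, ∞)`, `a ↦ a φ(a)` is non-decreasing on `(0, ∞)`, and `Ψ` is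
uniformly bounded. -/
def IsJoint {d : ℕ} (Ψ : Vec d → Vec d) : Prop :=
  ∃ φ : ℝ → ℝ,
    (∀ x : Vec d, Ψ x = φ ‖x‖ • x) ∧
    {s : ℝ | ¬ ContinuousAt φ s}.Finite ∧
    MonotoneOn (fun s => s * φ s) (Set.Ioi 0) ∧
    AntitoneOn φ (Set.Ioi 0) ∧
    (∀ s > 0, 0 < φ s) ∧
    (∃ C₂ > 0, ∀ x : Vec d, ‖φ ‖x‖ • x‖ ≤ C₂)

/-- A family of probability densities `P x` on `ℝ^d`, one for every state `x`, each of them symmetric,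
and positive around the origin uniformly in the state. -/
structure SymmetricDensities {d : ℕ} (P : Vec d → Vec d → ℝ) : Prop where
  measurable : Measurable (Function.uncurry P)
  nonneg : ∀ x z, 0 ≤ P x z
  integral_eq_one : ∀ x, ∫ z, P x z = 1
  symm : ∀ x z, P x (-z) = P x z
  pos : ∃ E₀ > 0, ∀ z : Vec d, ‖z‖ ≤ E₀ → 0 < ⨅ x, P x z

/-- The densities are bounded away from zero on a ball around the origin, uniformly both in the state
and in the point of the ball. -/
def UniformlyPositiveOnBall {d : ℕ} (P : Vec d → Vec d → ℝ) : Prop :=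
  ∃ E₀ > 0, ∃ p > 0, ∀ x z : Vec d, ‖z‖ ≤ E₀ → p ≤ P x z

/-- The denoised nonlinearity `Φ_x(y) = ∫ Ψ(y + z) P_x(z) dz`. -/
def denoised {d : ℕ} (Ψ : Vec d → Vec d) (P : Vec d → Vec d → ℝ) (x y : Vec d) : Vec d :=
  ∫ z, P x z • Ψ (y + z)

/-- `β₁, β₂` are positive constants with `⟨Φ_x(y), y⟩ ≥ min {β₁‖y‖, β₂‖y‖²}` for all `x, y`. -/
def DenoisingConstants {d : ℕ} (Ψ : Vec d → Vec d) (P : Vec d → Vec d → ℝ) (β₁ β₂ : ℝ) : Prop :=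
  0 < β₁ ∧ 0 < β₂ ∧
    ∀ x y : Vec d, min (β₁ * ‖y‖) (β₂ * ‖y‖ ^ 2) ≤ inner ℝ (denoised Ψ P x y) y

/-- The stochastic gradient `∇f(x^t; ξ^t)` returned by the oracle in iteration `t`. -/
def stochGrad {d : ℕ} {Ω Ξ : Type*} (f : Vec d → Ξ → ℝ) (ξ : ℕ → Ω → Ξ) (x : ℕ → Ω → Vec d)
    (t : ℕ) (ω : Ω) : Vec d :=
  gradient (fun u => f u (ξ t ω)) (x t ω)

/-- The stochastic noise `z^t = ∇f(x^t; ξ^t) - ∇F(x^t)`. -/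
def noise {d : ℕ} {Ω Ξ : Type*} (F : Vec d → ℝ) (f : Vec d → Ξ → ℝ) (ξ : ℕ → Ω → Ξ)
    (x : ℕ → Ω → Vec d) (t : ℕ) (ω : Ω) : Vec d :=
  stochGrad f ξ x t ω - gradient F (x t ω)

/-- The step-size `α_t = a / (t + 1)^η`. -/
def stepSize (a η : ℝ) (t : ℕ) : ℝ := a / ((t : ℝ) + 1) ^ η

/-- `x^1, x^2, …` are the models generated by nonlinear SGD, started at the deterministic point `x₁`
(time starts at `1`; the value `x 0` plays no role). -/
structure IsNSGD {d : ℕ} {Ω Ξ : Type*} (Ψ : Vec d → Vec d) (f : Vec d → Ξ → ℝ) (ξ : ℕ → Ω → Ξ)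
    (α : ℕ → ℝ) (x₁ : Vec d) (x : ℕ → Ω → Vec d) : Prop where
  init : ∀ ω, x 1 ω = x₁
  step : ∀ t, 1 ≤ t → ∀ ω, x (t + 1) ω = x t ω - α t • Ψ (stochGrad f ξ x t ω)

/-- The σ-algebra generated by `x^1, …, x^t`. -/
abbrev history {d : ℕ} {Ω : Type*} (x : ℕ → Ω → Vec d) (t : ℕ) : MeasurableSpace Ω :=
  ⨆ s ∈ Set.Icc 1 t, MeasurableSpace.comap (x s) inferInstance

/-- For every `t ≥ 1`, conditionally on `x^1, …, x^t`, the random vector `z^t` has density `P_{x^t}`: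
it depends on the past only through the current state, and on the state through the density. -/
structure HasStateDensity {d : ℕ} {Ω : Type*} [MeasurableSpace Ω] (μ : Measure Ω)
    (P : Vec d → Vec d → ℝ) (x z : ℕ → Ω → Vec d) : Prop where
  measurable : ∀ t, 1 ≤ t → Measurable (z t)
  condProb : ∀ t, 1 ≤ t → ∀ B : Set (Vec d), MeasurableSet B →
    μ[(z t ⁻¹' B).indicator (fun _ => (1 : ℝ)) | history x t]
      =ᵐ[μ] fun ω => ∫ v in B, P (x t ω) v

/-- `min_{1 ≤ k ≤ t} ‖∇F(x^k)‖²`. -/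
def minSqGrad {d : ℕ} {Ω : Type*} (F : Vec d → ℝ) (x : ℕ → Ω → Vec d) (t : ℕ) (ht : 1 ≤ t)
    (ω : Ω) : ℝ :=
  (Finset.Icc 1 t).inf' (Finset.nonempty_Icc.mpr ht) (fun k => ‖gradient F (x k ω)‖ ^ 2)

end NSGD

end

noncomputable section

namespace NSGD

variable {d : ℕ}

/-! Existence of `β₁, β₂`. Symmetry of the noise gives `2⟨Φ_x(y), y⟩ = ∫ (⟨Ψ(y+z), y⟩ + ⟨Ψ(y-z), y⟩)
P_x(z) dz`, and monotonicity makes the integrand nonnegative. It therefore suffices to bound it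
below on a set near the origin whose mass is bounded below uniformly in `x`. For component-wise `Ψ`
the integrand is a sum of central differences of `ψ`. For joint `Ψ` it grows linearly in `‖y‖` far
out, and quadratically near zero if `z` is not aligned with `y`: in dimension at least two such a
ball of `z` exists, while on the line the uniform density bound replaces it.

Convergence. By the descent lemma one step changes `F` by at most `-α⟨Ψ(g+z), g⟩ + LC²α²`, with `g`
the current gradient. Hoeffding's lemma bounds the conditional exponential moment of the first term
by `exp(-α⟨Φ_x(g), g⟩ + α²C²‖g‖²/2)`. Since `‖g‖` grows at most like `t^(1-η)` and `η ≥ 1/2`, the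
step-size condition makes the variance term at most half of the guaranteed decrease. Hence
`exp(potential)` has expectation at most one (`lintegral_exp_potential_le_one`), and Markov's
inequality bounds the weighted sum of decreases. Finally `minSqGrad_le` inverts the minimum in (1),
using that the smallest gradient norm never exceeds the initial one. -/

/-! ### Measurability of the nonlinearity -/

theorem IsComponentwise.measurable {Ψ : Vec d → Vec d} (h : IsComponentwise Ψ) : Measurable Ψ := by
  obtain ⟨ψ, hψ, hc, -⟩ := h
  have : Ψ = fun x => WithLp.toLp 2 (fun i => ψ (x i)) := by
    ext x i
    simp [hψ]
  rw [this]
  have := hc.continuous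
  fun_prop

/-- The function `s φ(s)`, extended by zero to `s ≤ 0`, is monotone and hence Borel; dividing by
`‖x‖` recovers the factor. The value `φ 0` is irrelevant, as it multiplies the zero vector. -/
theorem IsJoint.measurable {Ψ : Vec d → Vec d} (h : IsJoint Ψ) : Measurable Ψ := by
  obtain ⟨φ, hφ, -, hmono, -, hpos, -⟩ := h
  have hg : Monotone fun s : ℝ => if 0 < s then s * φ s else 0 := by
    intro s t hst
    by_cases hs : 0 < s
    · have ht : 0 < t := hs.trans_le hst
      simpa [hs, ht] using hmono hs ht hst
    · by_cases ht : 0 < t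
      · simpa [hs, ht] using (mul_pos ht (hpos t ht)).le
      · simp [hs, ht]
  have hΨ : Ψ = fun x => (‖x‖⁻¹ * if 0 < ‖x‖ then ‖x‖ * φ ‖x‖ else 0) • x := by
    ext1 x
    rw [hφ]
    rcases eq_or_ne x 0 with rfl | hx
    · simp
    · have : 0 < ‖x‖ := norm_pos_iff.2 hx
      simp only [this, if_true]
      rw [inv_mul_cancel_left₀ this.ne']
  rw [hΨ]
  exact ((measurable_norm.inv).mul (hg.measurable.comp measurable_norm)).smul measurable_id

/-! ### Noise laws: symmetrisation and uniform mass near the origin -/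

/-- The probability measure with density `P x`. -/
def stateMeasure (P : Vec d → Vec d → ℝ) (x : Vec d) : Measure (Vec d) :=
  volume.withDensity fun z => ENNReal.ofReal (P x z)

namespace SymmetricDensities

variable {P : Vec d → Vec d → ℝ} (hP : SymmetricDensities P)
include hP

theorem measurable_section (x : Vec d) : Measurable (P x) :=
  hP.measurable.comp measurable_prodMk_left

theorem integrable (x : Vec d) : Integrable (P x) := by
  by_contra h
  have := hP.integral_eq_one x
  rw [integral_undef h] at this
  exact zero_ne_one this

theorem stateMeasure_apply (x : Vec d) {B : Set (Vec d)} (hB : MeasurableSet B) :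
    stateMeasure P x B = ENNReal.ofReal (∫ z in B, P x z) := by
  rw [stateMeasure, withDensity_apply _ hB,
    ofReal_integral_eq_lintegral_ofReal (hP.integrable x).integrableOn
      (Filter.Eventually.of_forall (hP.nonneg x))]

theorem isProbabilityMeasure (x : Vec d) : IsProbabilityMeasure (stateMeasure P x) := by
  refine ⟨?_⟩
  rw [hP.stateMeasure_apply x MeasurableSet.univ, Measure.restrict_univ, hP.integral_eq_one]
  simp

theorem integral_stateMeasure {E : Type*} [NormedAddCommGroup E] [NormedSpace ℝ E] (x : Vec d)
    (g : Vec d → E) : ∫ z, g z ∂stateMeasure P x = ∫ z, P x z • g z := by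
  rw [stateMeasure, integral_withDensity_eq_integral_toReal_smul
    (hP.measurable_section x).ennreal_ofReal (by simp)]
  simp only [ENNReal.toReal_ofReal (hP.nonneg x _)]

theorem integral_stateMeasure_neg {E : Type*} [NormedAddCommGroup E] [NormedSpace ℝ E] (x : Vec d)
    (g : Vec d → E) : ∫ z, g (-z) ∂stateMeasure P x = ∫ z, g z ∂stateMeasure P x := by
  rw [hP.integral_stateMeasure, hP.integral_stateMeasure,
    ← integral_neg_eq_self (fun z => P x z • g z)]
  simp only [hP.symm]

theorem denoised_eq (Ψ : Vec d → Vec d) (x y : Vec d) :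
    denoised Ψ P x y = ∫ z, Ψ (y + z) ∂stateMeasure P x :=
  (hP.integral_stateMeasure x _).symm

theorem integrable_translate {Ψ : Vec d → Vec d} (hΨ : Measurable Ψ) {C : ℝ}
    (hC : ∀ v, ‖Ψ v‖ ≤ C) (x y : Vec d) :
    Integrable (fun z => Ψ (y + z)) (stateMeasure P x) := by
  have := hP.isProbabilityMeasure x
  exact Integrable.of_bound (hΨ.comp (measurable_const_add y)).aestronglyMeasurable C
    (Filter.Eventually.of_forall fun z => hC _)

theorem inner_denoised_eq {Ψ : Vec d → Vec d} (hΨ : Measurable Ψ) {C : ℝ}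
    (hC : ∀ v, ‖Ψ v‖ ≤ C) (x y : Vec d) :
    inner ℝ (denoised Ψ P x y) y = ∫ z, inner ℝ (Ψ (y + z)) y ∂stateMeasure P x := by
  rw [hP.denoised_eq, real_inner_comm, ← integral_inner (hP.integrable_translate hΨ hC x y)]
  simp only [real_inner_comm]

/-- Symmetrisation of the denoised nonlinearity. -/
theorem two_mul_inner_denoised {Ψ : Vec d → Vec d} (hΨ : Measurable Ψ) {C : ℝ}
    (hC : ∀ v, ‖Ψ v‖ ≤ C) (x y : Vec d) :
    2 * inner ℝ (denoised Ψ P x y) y =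
      ∫ z, (inner ℝ (Ψ (y + z)) y + inner ℝ (Ψ (y - z)) y) ∂stateMeasure P x := by
  have := hP.isProbabilityMeasure x
  have h1 : Integrable (fun z => inner ℝ (Ψ (y + z)) y) (stateMeasure P x) :=
    (hP.integrable_translate hΨ hC x y).inner_const y
  have h2 : Integrable (fun z => inner ℝ (Ψ (y - z)) y) (stateMeasure P x) := by
    refine Integrable.inner_const ?_ y
    exact Integrable.of_bound (hΨ.comp (measurable_const.sub measurable_id)).aestronglyMeasurable C
      (Filter.Eventually.of_forall fun z => hC _)
  rw [integral_add h1 h2, ← hP.integral_stateMeasure_neg x (fun z => inner ℝ (Ψ (y - z)) y)]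
  simp only [sub_neg_eq_add]
  rw [← hP.inner_denoised_eq hΨ hC]
  ring

/-- Since the symmetrised integrand is nonnegative, everything outside `S` can be discarded. This
reduces (1) to pointwise bounds on a well-chosen `S`. -/
theorem mul_le_two_mul_inner_denoised {Ψ : Vec d → Vec d} (hΨ : Measurable Ψ) {C : ℝ}
    (hC : ∀ v, ‖Ψ v‖ ≤ C) (x y : Vec d)
    (h0 : ∀ z, 0 ≤ inner ℝ (Ψ (y + z)) y + inner ℝ (Ψ (y - z)) y)
    {S : Set (Vec d)} (hS : MeasurableSet S) {k q : ℝ} (hk : 0 ≤ k)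
    (hS' : ∀ z ∈ S, k ≤ inner ℝ (Ψ (y + z)) y + inner ℝ (Ψ (y - z)) y)
    (hq : q ≤ (stateMeasure P x).real S) :
    k * q ≤ 2 * inner ℝ (denoised Ψ P x y) y := by
  have := hP.isProbabilityMeasure x
  rw [hP.two_mul_inner_denoised hΨ hC]
  calc k * q ≤ k * (stateMeasure P x).real S := by gcongr
    _ = ∫ z, S.indicator (fun _ => k) z ∂stateMeasure P x := by
        rw [integral_indicator hS, setIntegral_const, smul_eq_mul, mul_comm]
    _ ≤ _ := by
        refine integral_mono ((integrable_const k).indicator hS) ?_ ?_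
        · refine Integrable.of_bound (C := C * ‖y‖ + C * ‖y‖) ?_ (Filter.Eventually.of_forall ?_)
          · have h1 := hΨ.comp (measurable_const_add y)
            have h2 := hΨ.comp (measurable_const.sub measurable_id : Measurable fun z => y - z)
            exact ((h1.inner measurable_const).add
              (h2.inner measurable_const)).aestronglyMeasurable
          · intro z
            refine (norm_add_le _ _).trans (add_le_add ?_ ?_)
            · exact (norm_inner_le_norm _ _).trans (by gcongr; exact hC _)
            · exact (norm_inner_le_norm _ _).trans (by gcongr; exact hC _)
        · intro z
          by_cases hz : z ∈ S
          · simpa [hz] using hS' z hz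
          · simpa [hz] using h0 z

/-- A set of positive volume near the origin carries mass bounded away from zero uniformly in the
state. The pointwise infimum of the densities need not be measurable; outer measure suffices. -/
theorem exists_le_stateMeasure {E₀ : ℝ} (hE : ∀ z : Vec d, ‖z‖ ≤ E₀ → 0 < ⨅ x, P x z)
    {S : Set (Vec d)} (hS : MeasurableSet S) (hSE : ∀ z ∈ S, ‖z‖ ≤ E₀) (hvol : volume S ≠ 0) :
    ∃ q > 0, ∀ x, q ≤ (stateMeasure P x).real S := by
  -- The sets `A n` exhaust `S`, so by countable subadditivity one of them has positive outer
  -- measure, with `n` independent of the state.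
  let A : ℕ → Set (Vec d) := fun n => {z ∈ S | 1 / ((n : ℝ) + 1) ≤ ⨅ x, P x z}
  have hA : Monotone A := by
    intro m n hmn z hz
    refine ⟨hz.1, le_trans ?_ hz.2⟩
    have : (m : ℝ) ≤ n := by exact_mod_cast hmn
    gcongr
  have hU : ⋃ n, A n = S := by
    ext z
    simp only [Set.mem_iUnion]
    constructor
    · rintro ⟨n, hn⟩
      exact hn.1
    · intro hz
      obtain ⟨n, hn⟩ := exists_nat_one_div_lt (hE z (hSE z hz))
      exact ⟨n, hz, hn.le⟩
  obtain ⟨n, hn⟩ : ∃ n, volume (A n) ≠ 0 := by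
    by_contra! h
    apply hvol
    rw [← hU]
    exact measure_iUnion_null h
  have hAS : volume (A n) ≠ ⊤ := by
    refine ne_top_of_le_ne_top (measure_closedBall_lt_top (x := (0 : Vec d)) (r := E₀)).ne
      (measure_mono fun z hz => ?_)
    simpa using hSE z hz.1
  refine ⟨1 / ((n : ℝ) + 1) * (volume (A n)).toReal,
    mul_pos Nat.one_div_pos_of_nat (ENNReal.toReal_pos hn hAS), fun x => ?_⟩
  have := hP.isProbabilityMeasure x
  let B : Set (Vec d) := {z ∈ S | 1 / ((n : ℝ) + 1) ≤ P x z}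
  have hB : MeasurableSet B :=
    hS.inter (measurableSet_le measurable_const (hP.measurable_section x))
  have hAB : A n ⊆ B := fun z hz =>
    ⟨hz.1, hz.2.trans (ciInf_le ⟨0, by rintro _ ⟨x, rfl⟩; exact hP.nonneg x z⟩ x)⟩
  have key : ENNReal.ofReal (1 / ((n : ℝ) + 1)) * volume (A n) ≤ stateMeasure P x S := by
    calc _ ≤ ENNReal.ofReal (1 / ((n : ℝ) + 1)) * volume B := by gcongr
      _ = ∫⁻ _ in B, ENNReal.ofReal (1 / ((n : ℝ) + 1)) := by rw [setLIntegral_const]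
      _ ≤ ∫⁻ z in B, ENNReal.ofReal (P x z) :=
          setLIntegral_mono (hP.measurable_section x).ennreal_ofReal
            fun z hz => ENNReal.ofReal_le_ofReal hz.2
      _ = stateMeasure P x B := by rw [stateMeasure, withDensity_apply _ hB]
      _ ≤ stateMeasure P x S := measure_mono fun z hz => hz.1
  have := ENNReal.toReal_mono (measure_ne_top _ _) key
  rwa [ENNReal.toReal_mul, ENNReal.toReal_ofReal Nat.one_div_pos_of_nat.le] at this

theorem exists_le_stateMeasure_ball {E₀ : ℝ} (hE : ∀ z : Vec d, ‖z‖ ≤ E₀ → 0 < ⨅ x, P x z)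
    {v : Vec d} {r : ℝ} (hr : 0 < r) (hv : ‖v‖ + r ≤ E₀) :
    ∃ q > 0, ∀ x, q ≤ (stateMeasure P x).real (Metric.ball v r) := by
  refine hP.exists_le_stateMeasure hE measurableSet_ball (fun z hz => ?_)
    (Metric.measure_ball_pos _ _ hr).ne'
  rw [mem_ball_iff_norm] at hz
  have := norm_le_norm_add_norm_sub' z v
  linarith

end SymmetricDensities

/-! ### Denoising constants for component-wise nonlinearities -/

/-- A monotone `C¹` function that increases strictly near the origin has central differences of at
least linear growth, saturating at `h`, around some point close to the origin. -/
theorem exists_central_difference_bound {ψ : ℝ → ℝ} (hψ : ContDiff ℝ 1 ψ) (hmono : Monotone ψ)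
    {c : ℝ} (hc : 0 < c) (hstrict : StrictMonoOn ψ (Set.Ioo (-c) c)) {E₀ : ℝ} (hE : 0 < E₀) :
    ∃ s h κ : ℝ, 0 < h ∧ 0 < κ ∧ |s| + h ≤ E₀ ∧
      ∀ z y, |z - s| < h → 0 ≤ y → 2 * κ * min y h ≤ ψ (z + y) - ψ (z - y) := by
  have hdiff : Differentiable ℝ ψ := hψ.differentiable (by norm_num)
  set b := min c E₀ / 2 with hb
  have hb0 : 0 < b := by positivity
  have hbc : b < c := by have := min_le_left c E₀; linarith
  have hbE : b ≤ E₀ / 2 := by have := min_le_right c E₀; linarith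
  -- Strict monotonicity allows `ψ'(0) = 0`, so a point of positive slope is taken from the mean
  -- value theorem on `[0, b]`.
  obtain ⟨s, hs, hs'⟩ := exists_deriv_eq_slope ψ hb0 hψ.continuous.continuousOn
    hdiff.differentiableOn
  have hpos : 0 < deriv ψ s := by
    rw [hs']
    have : ψ 0 < ψ b := hstrict ⟨by linarith, hc⟩ ⟨by linarith, hbc⟩ hb0
    exact div_pos (by linarith) (by linarith)
  have hcont : Continuous (deriv ψ) := hψ.continuous_deriv le_rfl
  obtain ⟨ε, hε, hball⟩ := Metric.eventually_nhds_iff.1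
    (hcont.continuousAt.eventually (lt_mem_nhds (half_lt_self hpos)))
  have hh : 0 < min (ε / 4) (E₀ / 2) := by positivity
  have hh1 : min (ε / 4) (E₀ / 2) ≤ ε / 4 := min_le_left _ _
  have hh2 : min (ε / 4) (E₀ / 2) ≤ E₀ / 2 := min_le_right _ _
  set h := min (ε / 4) (E₀ / 2)
  refine ⟨s, h, deriv ψ s / 2, hh, half_pos hpos, ?_, ?_⟩
  · rw [abs_of_pos hs.1]
    linarith [hs.2]
  intro z y hz hy
  have hy' : 0 ≤ min y h := le_min hy hh.le
  have hyh : min y h ≤ h := min_le_right _ _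
  have hyy : min y h ≤ y := min_le_left _ _
  -- Truncating the increment at `h` keeps both arguments within `2h < ε` of `s`, where the slope
  -- exceeds half of `ψ'(s)`; monotonicity covers the rest of the increment.
  have key : deriv ψ s / 2 * ((z + min y h) - (z - min y h)) ≤
      ψ (z + min y h) - ψ (z - min y h) := by
    refine Convex.mul_sub_le_image_sub_of_le_deriv (convex_Icc (s - 2 * h) (s + 2 * h))
      hψ.continuous.continuousOn hdiff.differentiableOn ?_ _ ?_ _ ?_ (by linarith)
    · intro w hw
      rw [interior_Icc] at hw
      refine (hball ?_).le
      rw [Real.dist_eq, abs_lt]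
      constructor <;> linarith [hw.1, hw.2]
    · rw [abs_lt] at hz
      constructor <;> linarith [hz.1, hz.2]
    · rw [abs_lt] at hz
      constructor <;> linarith [hz.1, hz.2]
  have h1 : ψ (z + min y h) ≤ ψ (z + y) := hmono (by linarith)
  have h2 : ψ (z - y) ≤ ψ (z - min y h) := hmono (by linarith)
  linarith

theorem exists_norm_sq_le_mul_sq (y : Vec d) [Nonempty (Fin d)] :
    ∃ i, ‖y‖ ^ 2 ≤ d * y i ^ 2 := by
  obtain ⟨i, hi⟩ := Finite.exists_max fun i => y i ^ 2
  refine ⟨i, ?_⟩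
  rw [EuclideanSpace.real_norm_sq_eq]
  calc _ ≤ ∑ _j : Fin d, y i ^ 2 := Finset.sum_le_sum fun j _ => hi j
    _ = _ := by simp

/-- All coordinates contribute nonnegatively, so only the largest one, of size at least `‖y‖/√d`, is
kept. A ball around `s e_i` forces the `i`-th noise coordinate into the good window; the least of
the finitely many ball masses serves every `i`. -/
theorem exists_denoisingConstants_of_isComponentwise [Nonempty (Fin d)] {Ψ : Vec d → Vec d}
    {P : Vec d → Vec d → ℝ} (hΨ : IsComponentwise Ψ) (hP : SymmetricDensities P) {C : ℝ}
    (hC : ∀ v, ‖Ψ v‖ ≤ C) : ∃ β₁ β₂ : ℝ, DenoisingConstants Ψ P β₁ β₂ := by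
  have hmeas := hΨ.measurable
  obtain ⟨ψ, hψ, hcd, hmono, hodd, ⟨c, hc, hstrict⟩, -⟩ := hΨ
  obtain ⟨E₀, hE, hpos⟩ := hP.pos
  obtain ⟨s, h, κ, hh, hκ, hsh, hdiff⟩ :=
    exists_central_difference_bound (hcd.of_le (by norm_num)) hmono hc hstrict hE
  have hball : ∀ i : Fin d, ∃ q > 0, ∀ x,
      q ≤ (stateMeasure P x).real (Metric.ball (EuclideanSpace.single i s) h) := fun i =>
    hP.exists_le_stateMeasure_ball hpos hh (by simpa using hsh)
  choose q hq hqx using hball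
  obtain ⟨i₀, hi₀⟩ := Finite.exists_min q
  have hd : 0 < d := Fin.pos_iff_nonempty.2 inferInstance
  have hr : 0 < √(d : ℝ) := by positivity
  -- Oddness turns the symmetrised sum into a central difference at `z` with increment `|y|`.
  have hterm : ∀ y z : ℝ, (ψ (y + z) + ψ (y - z)) * y = (ψ (z + |y|) - ψ (z - |y|)) * |y| := by
    intro y z
    rcases abs_cases y with ⟨h1, -⟩ | ⟨h1, -⟩ <;> rw [h1]
    · rw [show y - z = -(z - y) by ring, hodd, add_comm y z]
      ring
    · rw [show y - z = -(z + -y) by ring, hodd, show z - -y = y + z by ring]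
      ring
  have hinner : ∀ y z : Vec d, inner ℝ (Ψ (y + z)) y + inner ℝ (Ψ (y - z)) y =
      ∑ i, (ψ (z i + |y i|) - ψ (z i - |y i|)) * |y i| := by
    intro y z
    simp only [PiLp.inner_apply, hψ, ← Finset.sum_add_distrib, ← hterm]
    refine Finset.sum_congr rfl fun i _ => ?_
    simp
    ring
  have hnn : ∀ a b : ℝ, 0 ≤ (ψ (a + |b|) - ψ (a - |b|)) * |b| := fun a b =>
    mul_nonneg (sub_nonneg.2 (hmono (by linarith [abs_nonneg b]))) (abs_nonneg b)
  refine ⟨κ * q i₀ * h / √d, κ * q i₀ / d, by have := hq i₀; positivity,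
    by have := hq i₀; positivity, fun x y => ?_⟩
  obtain ⟨i, hi⟩ := exists_norm_sq_le_mul_sq y
  have hyi : ‖y‖ / √d ≤ |y i| := by
    rw [div_le_iff₀ hr]
    refine le_of_abs_le (abs_le_of_sq_le_sq ?_ (by positivity))
    rw [mul_pow, sq_abs, Real.sq_sqrt (by positivity)]
    linarith
  have key := hP.mul_le_two_mul_inner_denoised hmeas hC x y
    (k := 2 * κ * min |y i| h * |y i|) (S := Metric.ball (EuclideanSpace.single i s) h)
    (fun z => by rw [hinner]; exact Finset.sum_nonneg fun j _ => hnn _ _)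
    measurableSet_ball (by positivity) (fun z hz => by
      rw [hinner]
      refine le_trans ?_ (Finset.single_le_sum (fun j _ => hnn (z j) (y j)) (Finset.mem_univ i))
      refine mul_le_mul_of_nonneg_right (hdiff _ _ ?_ (abs_nonneg _)) (abs_nonneg _)
      rw [mem_ball_iff_norm] at hz
      refine lt_of_le_of_lt ?_ hz
      simpa using PiLp.norm_apply_le (z - EuclideanSpace.single i s) i) (hqx i x)
  have hle : 2 * (κ * q i₀ * (min (‖y‖ / √d) h * (‖y‖ / √d))) ≤
      2 * κ * min |y i| h * |y i| * q i := by
    calc _ = 2 * κ * min (‖y‖ / √d) h * (‖y‖ / √d) * q i₀ := by ring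
      _ ≤ _ := by
        have := hq i₀
        have := hq i
        gcongr
        exact hi₀ i
  have hfin : min (κ * q i₀ * h / √d * ‖y‖) (κ * q i₀ / d * ‖y‖ ^ 2) ≤
      κ * q i₀ * (min (‖y‖ / √d) h * (‖y‖ / √d)) := by
    rcases min_cases (‖y‖ / √d) h with ⟨h1, -⟩ | ⟨h1, -⟩ <;> rw [h1]
    · refine (min_le_right _ _).trans (le_of_eq ?_)
      rw [div_mul_div_comm, Real.mul_self_sqrt (by positivity)]
      ring
    · refine (min_le_left _ _).trans (le_of_eq ?_)
      ring
  linarith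

/-! ### Denoising constants for joint nonlinearities -/

/-- The pairing of a joint nonlinearity with the midpoint of two vectors. -/
theorem two_mul_le_inner_joint_add {φ : ℝ → ℝ}
    (hmono : MonotoneOn (fun s => s * φ s) (Set.Ioi 0)) (hpos : ∀ s > 0, 0 < φ s) {m : ℝ}
    (u v : Vec d) (hu : u ≠ 0 → m ≤ φ ‖u‖) (hv : v ≠ 0 → m ≤ φ ‖v‖) :
    2 * m * (inner ℝ u v + ‖u‖ * ‖v‖) ≤ inner ℝ (φ ‖u‖ • u + φ ‖v‖ • v) (u + v) := by
  rcases eq_or_ne u 0 with rfl | hu0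
  · rcases eq_or_ne v 0 with rfl | hv0
    · simp
    · have := hpos ‖v‖ (norm_pos_iff.2 hv0)
      simp [inner_smul_left]
      positivity
  · have hnu := norm_pos_iff.2 hu0
    rcases eq_or_ne v 0 with rfl | hv0
    · have := hpos ‖u‖ hnu
      simp [inner_smul_left]
      positivity
    · have hnv := norm_pos_iff.2 hv0
      -- The pairing equals `(φ‖u‖ + φ‖v‖)(⟨u,v⟩ + ‖u‖‖v‖) + (‖u‖ - ‖v‖)(‖u‖φ‖u‖ - ‖v‖φ‖v‖)`. The
      -- last product is nonnegative by monotonicity, and so is the second factor of the first by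
      -- Cauchy–Schwarz.
      have hcs : 0 ≤ inner ℝ u v + ‖u‖ * ‖v‖ := by
        have := neg_le_of_abs_le (abs_real_inner_le_norm u v)
        linarith
      have h1 := mul_nonneg (sub_nonneg.2 (hu hu0)) hcs
      have h2 := mul_nonneg (sub_nonneg.2 (hv hv0)) hcs
      have h3 : 0 ≤ (‖u‖ - ‖v‖) * (‖u‖ * φ ‖u‖ - ‖v‖ * φ ‖v‖) := by
        rcases le_total ‖u‖ ‖v‖ with h | h
        · exact mul_nonneg_of_nonpos_of_nonpos (sub_nonpos.2 h)
            (sub_nonpos.2 (hmono hnu hnv h))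
        · exact mul_nonneg (sub_nonneg.2 h) (sub_nonneg.2 (hmono hnv hnu h))
      simp only [inner_add_left, inner_add_right, inner_smul_left, real_inner_self_eq_norm_sq,
        real_inner_comm u v, RCLike.conj_to_real]
      nlinarith

/-- This is the previous bound with `u = y + z` and `v = y - z`, whose sum is `2y`. -/
theorem le_inner_joint_add_joint_sub {φ : ℝ → ℝ}
    (hmono : MonotoneOn (fun s => s * φ s) (Set.Ioi 0)) (hpos : ∀ s > 0, 0 < φ s) {m : ℝ}
    (y z : Vec d) (hu : y + z ≠ 0 → m ≤ φ ‖y + z‖) (hv : y - z ≠ 0 → m ≤ φ ‖y - z‖) :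
    m * (‖y‖ ^ 2 - ‖z‖ ^ 2 + ‖y + z‖ * ‖y - z‖) ≤
      inner ℝ (φ ‖y + z‖ • (y + z)) y + inner ℝ (φ ‖y - z‖ • (y - z)) y := by
  have h := two_mul_le_inner_joint_add hmono hpos (y + z) (y - z) hu hv
  have h1 : inner ℝ (y + z) (y - z) = ‖y‖ ^ 2 - ‖z‖ ^ 2 := by
    rw [inner_add_left, inner_sub_right, inner_sub_right, real_inner_self_eq_norm_sq,
      real_inner_self_eq_norm_sq, real_inner_comm]
    ring
  rw [h1, show y + z + (y - z) = (2 : ℝ) • y by rw [two_smul]; abel, inner_smul_right,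
    inner_add_left] at h
  linarith

theorem inner_joint_add_joint_sub_nonneg {φ : ℝ → ℝ}
    (hmono : MonotoneOn (fun s => s * φ s) (Set.Ioi 0)) (hpos : ∀ s > 0, 0 < φ s)
    (y z : Vec d) :
    0 ≤ inner ℝ (φ ‖y + z‖ • (y + z)) y + inner ℝ (φ ‖y - z‖ • (y - z)) y := by
  have := le_inner_joint_add_joint_sub hmono hpos (m := 0) y z
    (fun h => (hpos _ (norm_pos_iff.2 h)).le) (fun h => (hpos _ (norm_pos_iff.2 h)).le)
  simpa using this

/-- Far from the origin, the pairing grows linearly. -/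
theorem linear_le_inner_joint_add_joint_sub {φ : ℝ → ℝ}
    (hmono : MonotoneOn (fun s => s * φ s) (Set.Ioi 0)) (hpos : ∀ s > 0, 0 < φ s) {r : ℝ}
    (hr : 0 < r) (y z : Vec d) (hz : ‖z‖ ≤ r) (hy : 2 * r ≤ ‖y‖) :
    r * φ r * ‖y‖ / 2 ≤
      inner ℝ (φ ‖y + z‖ • (y + z)) y + inner ℝ (φ ‖y - z‖ • (y - z)) y := by
  -- A vector `u` within `‖y‖/2` of `y` makes a small angle with `y`, and `‖u‖ ≥ r` gives `‖u‖φ(‖u‖)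
  -- ≥ rφ(r)`.
  have hin : ∀ u : Vec d, ‖u - y‖ ≤ r → r * φ r * ‖y‖ / 4 ≤ inner ℝ (φ ‖u‖ • u) y := by
    intro u hu
    have h1 : ‖y‖ ≤ ‖u‖ + ‖u - y‖ := by
      rw [norm_sub_rev]; exact norm_le_norm_add_norm_sub' y u
    have hru : r ≤ ‖u‖ := by linarith
    have hu0 : 0 < ‖u‖ := hr.trans_le hru
    have hm : r * φ r ≤ ‖u‖ * φ ‖u‖ := hmono hr hu0 hru
    have hφ := hpos _ hu0
    have h2 : ‖u - y‖ ^ 2 = ‖u‖ ^ 2 - 2 * inner ℝ u y + ‖y‖ ^ 2 := norm_sub_sq_real u y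
    have h3 : ‖u - y‖ ^ 2 ≤ (‖y‖ / 2) ^ 2 := by
      gcongr
      linarith
    have h4 : ‖u‖ * ‖y‖ / 4 ≤ inner ℝ u y := by nlinarith [sq_nonneg (‖u‖ - ‖y‖), norm_nonneg y]
    rw [inner_smul_left]
    calc r * φ r * ‖y‖ / 4 ≤ ‖u‖ * φ ‖u‖ * ‖y‖ / 4 := by gcongr
      _ = φ ‖u‖ * (‖u‖ * ‖y‖ / 4) := by ring
      _ ≤ _ := by simpa using mul_le_mul_of_nonneg_left h4 hφ.le
  have h1 := hin (y + z) (by simpa using hz)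
  have h2 := hin (y - z) (by simpa using hz)
  linarith

/-- Near the origin, the pairing grows quadratically if the noise is not aligned with `y`. -/
theorem quadratic_le_inner_joint_add_joint_sub {φ : ℝ → ℝ}
    (hmono : MonotoneOn (fun s => s * φ s) (Set.Ioi 0)) (hanti : AntitoneOn φ (Set.Ioi 0))
    (hpos : ∀ s > 0, 0 < φ s) {R : ℝ} (hR : 0 < R) (y z : Vec d) (hyz : ‖y‖ + ‖z‖ ≤ R)
    (hy : ‖y‖ ≤ ‖z‖) (hal : inner ℝ y z ^ 2 ≤ 9 / 10 * (‖y‖ ^ 2 * ‖z‖ ^ 2)) :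
    φ R * (‖y‖ ^ 2 / 8) ≤
      inner ℝ (φ ‖y + z‖ • (y + z)) y + inner ℝ (φ ‖y - z‖ • (y - z)) y := by
  refine le_trans ?_ (le_inner_joint_add_joint_sub hmono hpos (m := φ R) y z
    (fun h => hanti (norm_pos_iff.2 h) hR ((norm_add_le _ _).trans hyz))
    (fun h => hanti (norm_pos_iff.2 h) hR ((norm_sub_le _ _).trans hyz)))
  refine mul_le_mul_of_nonneg_left ?_ (hpos R hR).le
  have h1 := norm_add_sq_real y z
  have h2 := norm_sub_sq_real y z
  have hY : ‖y‖ ^ 2 ≤ ‖z‖ ^ 2 := by gcongr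
  -- With `Y = ‖y‖²` and `Z = ‖z‖²`, the squared right side is `(Y+Z)² - 4⟨y,z⟩² ≥ (Z-Y)² +
  -- (2/5)YZ`, which exceeds `(Z - 7Y/8)²` because `Y ≤ Z`.
  have h3 : ‖z‖ ^ 2 - ‖y‖ ^ 2 + ‖y‖ ^ 2 / 8 ≤ ‖y + z‖ * ‖y - z‖ := by
    refine le_of_abs_le (abs_le_of_sq_le_sq ?_ (by positivity))
    rw [mul_pow, h1, h2]
    nlinarith [mul_nonneg (sq_nonneg ‖y‖) (sub_nonneg.2 hY), sq_nonneg (‖y‖ ^ 2)]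
  linarith

theorem DenoisingConstants.of_two_regimes {Ψ : Vec d → Vec d} {P : Vec d → Vec d → ℝ}
    {r k₁ k₂ : ℝ} (hk₁ : 0 < k₁) (hk₂ : 0 < k₂)
    (h₁ : ∀ x y, r ≤ ‖y‖ → k₁ * ‖y‖ ≤ 2 * inner ℝ (denoised Ψ P x y) y)
    (h₂ : ∀ x y, ‖y‖ ≤ r → k₂ * ‖y‖ ^ 2 ≤ 2 * inner ℝ (denoised Ψ P x y) y) :
    DenoisingConstants Ψ P (k₁ / 2) (k₂ / 2) := by
  refine ⟨half_pos hk₁, half_pos hk₂, fun x y => ?_⟩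
  rcases le_total r ‖y‖ with h | h
  · refine (min_le_left _ _).trans ?_
    linarith [h₁ x y h]
  · refine (min_le_right _ _).trans ?_
    linarith [h₂ x y h]

/-- The linear lower bound of the denoised joint nonlinearity away from the origin. -/
theorem exists_linear_le_inner_denoised {φ : ℝ → ℝ}
    (hmono : MonotoneOn (fun s => s * φ s) (Set.Ioi 0)) (hpos : ∀ s > 0, 0 < φ s)
    {Ψ : Vec d → Vec d} (hΨ : Measurable Ψ) (hφ : ∀ x, Ψ x = φ ‖x‖ • x) {C : ℝ}
    (hC : ∀ v, ‖Ψ v‖ ≤ C) {P : Vec d → Vec d → ℝ} (hP : SymmetricDensities P)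
    {r : ℝ} (hr : 0 < r) :
    ∃ k > 0, ∀ x y, r ≤ ‖y‖ → k * ‖y‖ ≤ 2 * inner ℝ (denoised Ψ P x y) y := by
  obtain ⟨E₀, hE, hpE⟩ := hP.pos
  have hs : 0 < min (r / 2) E₀ := by positivity
  have hsr : min (r / 2) E₀ ≤ r / 2 := min_le_left _ _
  obtain ⟨q, hq, hqx⟩ := hP.exists_le_stateMeasure_ball hpE (v := 0) hs
    (by simp)
  set s := min (r / 2) E₀
  have := hpos s hs
  refine ⟨s * φ s / 2 * q, by positivity, fun x y hy => ?_⟩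
  have := hP.mul_le_two_mul_inner_denoised hΨ hC x y (k := s * φ s * ‖y‖ / 2)
    (fun z => by simpa only [hφ] using inner_joint_add_joint_sub_nonneg hmono hpos y z)
    measurableSet_ball (by positivity) (fun z hz => by
      simp only [hφ]
      refine linear_le_inner_joint_add_joint_sub hmono hpos hs y z ?_ (by linarith)
      simpa using (mem_ball_iff_norm.1 hz).le) (hqx x)
  linarith

/-- The quadratic lower bound of the denoised joint nonlinearity near the origin, in dimension at
least two. -/
theorem exists_quadratic_le_inner_denoised {φ : ℝ → ℝ}
    (hmono : MonotoneOn (fun s => s * φ s) (Set.Ioi 0)) (hanti : AntitoneOn φ (Set.Ioi 0))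
    (hpos : ∀ s > 0, 0 < φ s)
    {Ψ : Vec d → Vec d} (hΨ : Measurable Ψ) (hφ : ∀ x, Ψ x = φ ‖x‖ • x) {C : ℝ}
    (hC : ∀ v, ‖Ψ v‖ ≤ C) {P : Vec d → Vec d → ℝ} (hP : SymmetricDensities P)
    {i j : Fin d} (hij : i ≠ j) :
    ∃ r > 0, ∃ k > 0, ∀ x y, ‖y‖ ≤ r → k * ‖y‖ ^ 2 ≤ 2 * inner ℝ (denoised Ψ P x y) y := by
  obtain ⟨E₀, hE, hpE⟩ := hP.pos
  set c := E₀ / 2 with hc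
  have hc0 : 0 < c := by positivity
  have hball : ∀ l : Fin d, ∃ q > 0, ∀ x,
      q ≤ (stateMeasure P x).real (Metric.ball (EuclideanSpace.single l c) (c / 10)) := fun l => by
    refine hP.exists_le_stateMeasure_ball hpE (by positivity) ?_
    rw [PiLp.norm_single, Real.norm_of_nonneg hc0.le]
    linarith
  choose q hq hqx using hball
  have hm := hpos (2 * c) (by positivity)
  refine ⟨c / 2, by positivity, φ (2 * c) / 8 * min (q i) (q j),
    mul_pos (by positivity) (lt_min (hq i) (hq j)), fun x y hy => ?_⟩
  -- Of two coordinates of `y`, one carries at most half of `‖y‖²`; noise near that axis is not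
  -- aligned with `y`.
  have hcoord : ∃ l, (l = i ∨ l = j) ∧ y l ^ 2 ≤ ‖y‖ ^ 2 / 2 := by
    have hsum : y i ^ 2 + y j ^ 2 ≤ ‖y‖ ^ 2 := by
      rw [EuclideanSpace.real_norm_sq_eq, ← Finset.sum_pair (f := fun l => y l ^ 2) hij]
      exact Finset.sum_le_sum_of_subset_of_nonneg (Finset.subset_univ _)
        fun _ _ _ => sq_nonneg _
    by_cases h : y i ^ 2 ≤ ‖y‖ ^ 2 / 2
    · exact ⟨i, Or.inl rfl, h⟩
    · exact ⟨j, Or.inr rfl, by linarith⟩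
  obtain ⟨l, hl, hyl⟩ := hcoord
  have hql : min (q i) (q j) ≤ q l := by
    rcases hl with rfl | rfl
    · exact min_le_left _ _
    · exact min_le_right _ _
  have := hP.mul_le_two_mul_inner_denoised hΨ hC x y (k := φ (2 * c) * (‖y‖ ^ 2 / 8))
    (fun z => by simpa only [hφ] using inner_joint_add_joint_sub_nonneg hmono hpos y z)
    measurableSet_ball (by positivity) (fun z hz => by
      simp only [hφ]
      have hz' := (mem_ball_iff_norm.1 hz).le
      set w := z - EuclideanSpace.single l c with hw
      have hzw : z = EuclideanSpace.single l c + w := by rw [hw]; abel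
      have hn : ‖(EuclideanSpace.single l c : Vec d)‖ = c := by
        rw [PiLp.norm_single, Real.norm_of_nonneg hc0.le]
      have hz1 : ‖z‖ ≤ c + c / 10 := by
        rw [hzw]; exact (norm_add_le _ _).trans (by rw [hn]; linarith)
      have hz2 : 9 / 10 * c ≤ ‖z‖ := by
        have e := norm_sub_le z w
        rw [show z - w = EuclideanSpace.single l c by rw [hw]; abel, hn] at e
        linarith
      refine quadratic_le_inner_joint_add_joint_sub hmono hanti hpos (by positivity) y z
        (by linarith) (by linarith) ?_
      have hin : inner ℝ y z = c * y l + inner ℝ y w := by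
        rw [hzw, inner_add_right]
        simp [PiLp.inner_apply]
      have h1 : |inner ℝ y w| ≤ ‖y‖ * (c / 10) :=
        (abs_real_inner_le_norm y w).trans (by gcongr)
      have h2 : |y l| ≤ 71 / 100 * ‖y‖ := by
        refine abs_le_of_sq_le_sq ?_ (by positivity)
        nlinarith [sq_nonneg ‖y‖]
      -- The ball radius adds `1/10` to the `71/100 > 1/√2` from the coordinate. As `‖z‖ ≥ 9c/10`,
      -- non-alignment reduces to `0.81² ≤ 0.9³`.
      have h3 : |inner ℝ y z| ≤ 81 / 100 * c * ‖y‖ := by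
        rw [hin]
        refine (abs_add_le _ _).trans ?_
        rw [abs_mul, abs_of_pos hc0]
        nlinarith
      calc inner ℝ y z ^ 2 ≤ (81 / 100 * c * ‖y‖) ^ 2 := sq_le_sq' (neg_le_of_abs_le h3)
            (le_of_abs_le h3)
        _ ≤ 9 / 10 * (‖y‖ ^ 2 * (9 / 10 * c) ^ 2) := by
            have := mul_nonneg (sq_nonneg c) (sq_nonneg ‖y‖)
            nlinarith
        _ ≤ _ := by gcongr) (hql.trans (hqx l x))
  linarith

theorem monotone_mul_comp_abs {φ : ℝ → ℝ} (hmono : MonotoneOn (fun s => s * φ s) (Set.Ioi 0))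
    (hpos : ∀ s > 0, 0 < φ s) : Monotone fun s => s * φ |s| := by
  refine monotone_of_odd_of_monotoneOn_nonneg (fun s => by simp) fun s hs t ht hst => ?_
  rcases (Set.mem_Ici.1 hs).eq_or_lt with rfl | hs
  · rcases (Set.mem_Ici.1 ht).eq_or_lt with rfl | ht
    · rfl
    · simpa using (mul_pos ht (hpos _ (abs_pos.2 ht.ne'))).le
  · have ht := hs.trans_le hst
    simpa only [abs_of_pos hs, abs_of_pos ht] using hmono hs ht hst

/-- The mean of a monotone odd function over an interval grows at least linearly with its midpoint. -/
theorem two_mul_sq_mul_le_mul_integral {g : ℝ → ℝ} (hg : Monotone g) (hodd : ∀ s, g (-s) = -g s)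
    {E y : ℝ} (hy : |y| ≤ E / 2) :
    2 * y ^ 2 * g (E / 2) ≤ y * ∫ s in (y - E)..(y + E), g s := by
  have hint : ∀ a b, IntervalIntegrable g volume a b := fun a b => hg.intervalIntegrable
  have hneg : ∀ a b, ∫ s in (-b)..(-a), g s = -∫ s in a..b, g s := by
    intro a b
    rw [← intervalIntegral.integral_comp_neg]
    simp [hodd]
  have main : ∀ y, 0 ≤ y → y ≤ E / 2 →
      2 * y ^ 2 * g (E / 2) ≤ y * ∫ s in (y - E)..(y + E), g s := by
    intro y hy hyE
    -- The part of the interval symmetric about zero cancels. What remains has length `2y` and lies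
    -- to the right of `E/2`.
    have h0 : ∫ s in (y - E)..(E - y), g s = 0 := by
      have := hneg (y - E) (E - y)
      rw [neg_sub, neg_sub] at this
      linarith
    rw [← intervalIntegral.integral_add_adjacent_intervals (hint (y - E) (E - y))
      (hint (E - y) (y + E)), h0, zero_add]
    have h1 : ∫ _ in (E - y)..(y + E), g (E / 2) ≤ ∫ s in (E - y)..(y + E), g s := by
      refine intervalIntegral.integral_mono_on (by linarith) (by simp) (hint _ _) ?_
      intro s hs
      exact hg (by linarith [hs.1])
    rw [intervalIntegral.integral_const, smul_eq_mul] at h1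
    calc _ = y * ((y + E - (E - y)) * g (E / 2)) := by ring
      _ ≤ _ := by gcongr
  rcases le_total 0 y with h | h
  · exact main y h (le_of_abs_le hy)
  · have := main (-y) (by linarith) (by linarith [neg_le_of_abs_le hy])
    rw [show -y - E = -(y + E) by ring, show -y + E = -(y - E) by ring, hneg] at this
    linarith

theorem setIntegral_closedBall_vec_one (H : ℝ → ℝ) {E : ℝ} (hE : 0 ≤ E) :
    ∫ z in Metric.closedBall (0 : Vec 1) E, H (z 0) = ∫ s in (-E)..E, H s := by
  let e : Vec 1 ≃ᵐ ℝ := (MeasurableEquiv.toLp 2 (Fin 1 → ℝ)).symm.trans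
    (MeasurableEquiv.funUnique (Fin 1) ℝ)
  have he : MeasurePreserving e :=
    (volume_preserving_funUnique (Fin 1) ℝ).comp (PiLp.volume_preserving_ofLp (Fin 1))
  have hez : ∀ z : Vec 1, e z = z 0 := fun z => rfl
  have hpre : Metric.closedBall (0 : Vec 1) E = e ⁻¹' Set.Icc (-E) E := by
    ext z
    rw [mem_closedBall_zero_iff, Set.mem_preimage, hez, EuclideanSpace.norm_eq]
    simp [Real.sqrt_sq_eq_abs, abs_le]
  rw [hpre, intervalIntegral.integral_of_le (by linarith), ← integral_Icc_eq_integral_Ioc,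
    ← he.setIntegral_preimage_emb e.measurableEmbedding H]
  simp only [hez]

/-- The quadratic lower bound of the denoised joint nonlinearity near the origin, on the line. -/
theorem exists_quadratic_le_inner_denoised_vec_one {φ : ℝ → ℝ}
    (hmono : MonotoneOn (fun s => s * φ s) (Set.Ioi 0))
    (hpos : ∀ s > 0, 0 < φ s)
    {Ψ : Vec 1 → Vec 1} (hΨ : Measurable Ψ) (hφ : ∀ x, Ψ x = φ ‖x‖ • x) {C : ℝ}
    (hC : ∀ v, ‖Ψ v‖ ≤ C) {P : Vec 1 → Vec 1 → ℝ} (hP : SymmetricDensities P)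
    (hU : UniformlyPositiveOnBall P) :
    ∃ r > 0, ∃ k > 0, ∀ x y, ‖y‖ ≤ r → k * ‖y‖ ^ 2 ≤ 2 * inner ℝ (denoised Ψ P x y) y := by
  obtain ⟨E, hE, p, hp, hpE⟩ := hU
  set g : ℝ → ℝ := fun s => s * φ |s| with hg
  have hgm : Monotone g := monotone_mul_comp_abs hmono hpos
  have hodd : ∀ s, g (-s) = -g s := fun s => by simp [hg]
  have hnorm : ∀ y : Vec 1, ‖y‖ = |y 0| := fun y => by
    rw [EuclideanSpace.norm_eq]
    simp [Real.sqrt_sq_eq_abs]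
  have hgE : 0 < g (E / 2) := by
    have := hpos |E / 2| (by positivity)
    simp only [hg]
    positivity
  have hinner : ∀ y z : Vec 1, inner ℝ (Ψ (y + z)) y + inner ℝ (Ψ (y - z)) y =
      y 0 * (g (y 0 + z 0) + g (y 0 - z 0)) := by
    intro y z
    simp [hφ, PiLp.inner_apply, hnorm, hg]
    ring
  have hnn : ∀ y z : Vec 1, 0 ≤ inner ℝ (Ψ (y + z)) y + inner ℝ (Ψ (y - z)) y := fun y z => by
    simpa only [hφ] using inner_joint_add_joint_sub_nonneg hmono hpos y z
  refine ⟨E / 2, by positivity, 4 * p * g (E / 2), by positivity, fun x y hy => ?_⟩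
  rw [hnorm] at hy
  have := hP.isProbabilityMeasure x
  have hb : ∀ z, ‖inner ℝ (Ψ (y + z)) y + inner ℝ (Ψ (y - z)) y‖ ≤ C * ‖y‖ + C * ‖y‖ := by
    intro z
    refine (norm_add_le _ _).trans (add_le_add ?_ ?_) <;>
    exact (norm_inner_le_norm _ _).trans (by gcongr; exact hC _)
  have hmeas : Measurable fun z => inner ℝ (Ψ (y + z)) y + inner ℝ (Ψ (y - z)) y := by
    have h1 := hΨ.comp (measurable_const_add y)
    have h2 := hΨ.comp (measurable_const.sub measurable_id : Measurable fun z => y - z)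
    exact (h1.inner measurable_const).add (h2.inner measurable_const)
  have hint : Integrable fun z => P x z • (inner ℝ (Ψ (y + z)) y + inner ℝ (Ψ (y - z)) y) :=
    (hP.integrable x).mul_bdd hmeas.aestronglyMeasurable (Filter.Eventually.of_forall hb)
  have hballfin : IsFiniteMeasure (volume.restrict (Metric.closedBall (0 : Vec 1) E)) :=
    ⟨by simpa using measure_closedBall_lt_top⟩
  rw [hP.two_mul_inner_denoised hΨ hC, hP.integral_stateMeasure]
  -- On the line `z` is always parallel to `y`, and for `φ(s) = 1/s` the integrand vanishes when
  -- `|z| > |y|`. No fixed set away from zero suffices, so the density is replaced by `p` on the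
  -- whole ball and the integral is computed.
  calc 4 * p * g (E / 2) * ‖y‖ ^ 2 = 2 * p * (2 * y 0 ^ 2 * g (E / 2)) := by
        rw [hnorm, sq_abs]; ring
    _ ≤ 2 * p * (y 0 * ∫ s in (y 0 - E)..(y 0 + E), g s) := by
        exact mul_le_mul_of_nonneg_left (two_mul_sq_mul_le_mul_integral hgm hodd hy)
          (by positivity)
    _ = p * ∫ s in (-E)..E, y 0 * (g (y 0 + s) + g (y 0 - s)) := by
        have h1 : IntervalIntegrable (fun s => g (y 0 + s)) volume (-E) E :=
          Monotone.intervalIntegrable fun a b hab => hgm (by linarith)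
        have h2 : IntervalIntegrable (fun s => g (y 0 - s)) volume (-E) E :=
          Antitone.intervalIntegrable fun a b hab => hgm (by linarith)
        rw [intervalIntegral.integral_const_mul, intervalIntegral.integral_add h1 h2,
          intervalIntegral.integral_comp_add_left, intervalIntegral.integral_comp_sub_left]
        simp only [sub_neg_eq_add, ← sub_eq_add_neg]
        ring
    _ = ∫ z in Metric.closedBall (0 : Vec 1) E,
          p * (inner ℝ (Ψ (y + z)) y + inner ℝ (Ψ (y - z)) y) := by
        rw [integral_const_mul, ← setIntegral_closedBall_vec_one _ hE.le]
        simp only [hinner]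
    _ ≤ ∫ z in Metric.closedBall (0 : Vec 1) E,
          P x z • (inner ℝ (Ψ (y + z)) y + inner ℝ (Ψ (y - z)) y) := by
        refine setIntegral_mono_on ?_ hint.integrableOn Metric.isClosed_closedBall.measurableSet ?_
        · exact (Integrable.of_bound hmeas.aestronglyMeasurable _
            (Filter.Eventually.of_forall hb)).const_mul p
        · intro z hz
          exact mul_le_mul_of_nonneg_right (hpE x z (by simpa using hz)) (hnn y z)
    _ ≤ ∫ z, P x z • (inner ℝ (Ψ (y + z)) y + inner ℝ (Ψ (y - z)) y) :=
        setIntegral_le_integral hint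
          (Filter.Eventually.of_forall fun z => mul_nonneg (hP.nonneg x z) (hnn y z))

theorem IsComponentwise.exists_norm_le {Ψ : Vec d → Vec d} (h : IsComponentwise Ψ) :
    ∃ C, ∀ v, ‖Ψ v‖ ≤ C := by
  obtain ⟨ψ, hψ, -, -, -, -, ⟨K, hK, hb⟩, -⟩ := h
  refine ⟨√(∑ _i : Fin d, K ^ 2), fun v => ?_⟩
  rw [EuclideanSpace.norm_eq]
  gcongr with i
  rw [hψ]
  exact hb _

theorem exists_denoisingConstants {Ψ : Vec d → Vec d} {P : Vec d → Vec d → ℝ}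
    (hΨ : IsComponentwise Ψ ∨ IsJoint Ψ) (hP : SymmetricDensities P)
    (hd : d = 1 → ¬ IsComponentwise Ψ → UniformlyPositiveOnBall P) :
    ∃ β₁ β₂ : ℝ, DenoisingConstants Ψ P β₁ β₂ := by
  rcases Nat.eq_zero_or_pos d with rfl | hd0
  · refine ⟨1, 1, one_pos, one_pos, fun x y => ?_⟩
    simp [Subsingleton.elim y 0]
  have : Nonempty (Fin d) := Fin.pos_iff_nonempty.1 hd0
  -- A nonlinearity of both types is treated as component-wise, since the extra density bound on the
  -- line is available only otherwise.
  by_cases hcw : IsComponentwise Ψ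
  · obtain ⟨C, hC⟩ := hcw.exists_norm_le
    exact exists_denoisingConstants_of_isComponentwise hcw hP hC
  have hj := hΨ.resolve_left hcw
  have hmeas := hj.measurable
  obtain ⟨φ, hφ, -, hmono, hanti, hpos, C, hC0, hCφ⟩ := hj
  have hC : ∀ v, ‖Ψ v‖ ≤ C := fun v => by rw [hφ]; exact hCφ v
  have hquad : ∃ r > 0, ∃ k > 0, ∀ x y, ‖y‖ ≤ r →
      k * ‖y‖ ^ 2 ≤ 2 * inner ℝ (denoised Ψ P x y) y := by
    rcases (Nat.succ_le_iff.2 hd0).eq_or_lt with h1 | h2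
    · subst h1
      exact exists_quadratic_le_inner_denoised_vec_one hmono hpos hmeas hφ hC hP (hd rfl hcw)
    · exact exists_quadratic_le_inner_denoised hmono hanti hpos hmeas hφ hC hP
        (i := ⟨0, hd0⟩) (j := ⟨1, h2⟩) (by simp)
  obtain ⟨r, hr, k₂, hk₂, h₂⟩ := hquad
  -- The linear bound holds beyond any radius, so it can start where the quadratic one ends.
  obtain ⟨k₁, hk₁, h₁⟩ := exists_linear_le_inner_denoised hmono hpos hmeas hφ hC hP hr
  exact ⟨_, _, DenoisingConstants.of_two_regimes hk₁ hk₂ h₁ h₂⟩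

/-! ### Descent lemma and Hoeffding bound -/

theorem SmoothCost.continuous_gradient {F : Vec d → ℝ} {L : ℝ} (hF : SmoothCost F L) :
    Continuous (gradient F) := by
  refine (LipschitzWith.of_dist_le_mul (K := L.toNNReal) fun x y => ?_).continuous
  rw [dist_eq_norm, dist_eq_norm]
  refine (hF.lipschitz x y).trans ?_
  gcongr
  exact Real.le_coe_toNNReal L

/-- The descent lemma. -/
theorem SmoothCost.le_add_inner_add {F : Vec d → ℝ} {L : ℝ} (hF : SmoothCost F L) (hL : 0 ≤ L)
    (x y : Vec d) :
    F y ≤ F x + inner ℝ (gradient F x) (y - x) + L * ‖y - x‖ ^ 2 := by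
  -- The mean value inequality on the segment yields the constant `L` instead of the sharp `L/2`.
  have h := Convex.norm_image_sub_le_of_norm_hasFDerivWithin_le' (𝕜 := ℝ) (f := F)
    (s := segment ℝ x y) (x := x) (y := y) (C := L * ‖y - x‖)
    (f' := fun w => InnerProductSpace.toDual ℝ (Vec d) (gradient F w))
    (φ := InnerProductSpace.toDual ℝ (Vec d) (gradient F x))
    (fun w _ => (hF.differentiable w).hasGradientAt.hasFDerivAt.hasFDerivWithinAt)
    (fun w hw => by
      rw [← map_sub, LinearIsometryEquiv.norm_map]
      refine (hF.lipschitz w x).trans (mul_le_mul_of_nonneg_left ?_ hL)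
      exact norm_sub_le_of_mem_segment hw)
    (convex_segment x y) (left_mem_segment ℝ x y) (right_mem_segment ℝ x y)
  rw [InnerProductSpace.toDual_apply_apply, Real.norm_eq_abs] at h
  have := le_of_abs_le h
  nlinarith

/-- Hoeffding's lemma for the nonlinear stochastic gradient. -/
theorem SymmetricDensities.lintegral_exp_inner_le {Ψ : Vec d → Vec d} {P : Vec d → Vec d → ℝ}
    (hP : SymmetricDensities P) (hΨ : Measurable Ψ) {C : ℝ} (hC0 : 0 ≤ C) (hC : ∀ v, ‖Ψ v‖ ≤ C)
    (x y : Vec d) (α : ℝ) :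
    ∫⁻ z, ENNReal.ofReal (Real.exp (-α * inner ℝ (Ψ (y + z)) y)) ∂stateMeasure P x ≤
      ENNReal.ofReal (Real.exp (-α * inner ℝ (denoised Ψ P x y) y +
        α ^ 2 * C ^ 2 * ‖y‖ ^ 2 / 2)) := by
  have := hP.isProbabilityMeasure x
  have hmeas : Measurable fun z => inner ℝ (Ψ (y + z)) y :=
    (hΨ.comp (measurable_const_add y)).inner measurable_const
  have hmem : ∀ z, inner ℝ (Ψ (y + z)) y ∈ Set.Icc (-(C * ‖y‖)) (C * ‖y‖) := fun z =>
    abs_le.1 ((abs_real_inner_le_norm _ _).trans (by gcongr; exact hC _))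
  have h := ProbabilityTheory.hasSubgaussianMGF_of_mem_Icc (μ := stateMeasure P x)
    hmeas.aemeasurable (Filter.Eventually.of_forall hmem)
  rw [← hP.inner_denoised_eq hΨ hC] at h
  have hint := h.integrable_exp_mul (-α)
  have hle := h.mgf_le (-α)
  rw [ProbabilityTheory.mgf] at hle
  -- The pairing ranges over an interval of half-length `C‖y‖`, whose square is the variance proxy.
  have hc : ((((‖C * ‖y‖ - -(C * ‖y‖)‖₊ / 2) ^ 2 : NNReal)) : ℝ) = C ^ 2 * ‖y‖ ^ 2 := by
    push_cast
    rw [Real.norm_of_nonneg (by have := norm_nonneg y; nlinarith [mul_nonneg hC0 this])]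
    ring
  rw [hc] at hle
  set v := inner ℝ (denoised Ψ P x y) y
  have e1 : ∀ z, ENNReal.ofReal (Real.exp (-α * inner ℝ (Ψ (y + z)) y)) =
      ENNReal.ofReal (Real.exp (-α * v)) *
        ENNReal.ofReal (Real.exp (-α * (inner ℝ (Ψ (y + z)) y - v))) := by
    intro z
    rw [← ENNReal.ofReal_mul (Real.exp_nonneg _), ← Real.exp_add]
    congr 2
    ring
  simp only [e1]
  rw [lintegral_const_mul _ (by fun_prop), ← ofReal_integral_eq_lintegral_ofReal hint
    (Filter.Eventually.of_forall fun z => Real.exp_nonneg _),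
    ← ENNReal.ofReal_mul (Real.exp_nonneg _), Real.exp_add]
  gcongr
  refine hle.trans (le_of_eq ?_)
  congr 1
  ring

/-! ### Integrating out the noise given the past -/

/-- The densities as a Markov kernel. -/
def stateKernel (P : Vec d → Vec d → ℝ) : ProbabilityTheory.Kernel (Vec d) (Vec d) :=
  (ProbabilityTheory.Kernel.const (Vec d) volume).withDensity fun x z => ENNReal.ofReal (P x z)

namespace SymmetricDensities

variable {P : Vec d → Vec d → ℝ} (hP : SymmetricDensities P)
include hP

theorem stateKernel_apply (x : Vec d) : stateKernel P x = stateMeasure P x := by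
  rw [stateKernel, ProbabilityTheory.Kernel.withDensity_apply _ hP.measurable.ennreal_ofReal]
  rfl

theorem isMarkovKernel : ProbabilityTheory.IsMarkovKernel (stateKernel P) :=
  ⟨fun x => by rw [hP.stateKernel_apply]; exact hP.isProbabilityMeasure x⟩

end SymmetricDensities

/-- Disintegration of a joint law: `Z` is conditionally distributed given `X` according to a kernel
evaluated at the function `Y` of `X`. -/
theorem lintegral_mul_eq_lintegral_kernel {Ω Ω' S E : Type*} [MeasurableSpace Ω]
    [MeasurableSpace Ω'] [MeasurableSpace S] [MeasurableSpace E] {μ : Measure Ω}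
    [IsFiniteMeasure μ] {X : Ω → Ω'} (hX : Measurable X) {Z : Ω → E} (hZ : Measurable Z)
    {Y : Ω' → S} (hY : Measurable Y) (κ : ProbabilityTheory.Kernel S E)
    [ProbabilityTheory.IsMarkovKernel κ]
    (h : ∀ A, MeasurableSet A → ∀ B, MeasurableSet B →
      μ (X ⁻¹' A ∩ Z ⁻¹' B) = ∫⁻ ω in X ⁻¹' A, κ (Y (X ω)) B ∂μ)
    {W : Ω' → ENNReal} (hW : Measurable W) {H : S × E → ENNReal} (hH : Measurable H) :
    ∫⁻ ω, W (X ω) * H (Y (X ω), Z ω) ∂μ =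
      ∫⁻ ω, W (X ω) * ∫⁻ v, H (Y (X ω), v) ∂κ (Y (X ω)) ∂μ := by
  have hlaw : μ.map (fun ω => (X ω, Z ω)) = (μ.map X).compProd (κ.comap Y hY) := by
    refine Measure.ext_prod fun {A B} hA hB => ?_
    rw [Measure.map_apply (hX.prodMk hZ) (hA.prod hB), Measure.compProd_apply_prod hA hB,
      setLIntegral_map hA ((κ.comap Y hY).measurable_coe hB) hX]
    simp only [ProbabilityTheory.Kernel.comap_apply]
    rw [← h A hA B hB]
    rfl
  have hw : Measurable fun p : Ω' × E => W p.1 * H (Y p.1, p.2) := by fun_prop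
  have key : ∫⁻ ω, W (X ω) * H (Y (X ω), Z ω) ∂μ =
      ∫⁻ ω, ∫⁻ v, W (X ω) * H (Y (X ω), v) ∂κ.comap Y hY (X ω) ∂μ := by
    rw [← lintegral_map hw (hX.prodMk hZ), hlaw, Measure.lintegral_compProd hw,
      lintegral_map hw.lintegral_kernel_prod_right' hX]
  rw [key]
  refine lintegral_congr fun ω => ?_
  rw [lintegral_const_mul _ (by fun_prop),
    ProbabilityTheory.Kernel.comap_apply]

theorem HasStateDensity.measure_inter {Ω : Type*} [MeasurableSpace Ω] {μ : Measure Ω}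
    [IsProbabilityMeasure μ] {P : Vec d → Vec d → ℝ} {x z : ℕ → Ω → Vec d}
    (h : HasStateDensity μ P x z) (hP : SymmetricDensities P) {t : ℕ} (ht : 1 ≤ t)
    (hx : history x t ≤ ‹MeasurableSpace Ω›) {A : Set Ω} (hA : MeasurableSet[history x t] A)
    {B : Set (Vec d)} (hB : MeasurableSet B) :
    μ (A ∩ z t ⁻¹' B) = ∫⁻ ω in A, stateMeasure P (x t ω) B ∂μ := by
  have hA' : MeasurableSet A := hx A hA
  have hzB : MeasurableSet (z t ⁻¹' B) := h.measurable t ht hB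
  have hint : Integrable ((z t ⁻¹' B).indicator fun _ => (1 : ℝ)) μ :=
    (integrable_const 1).indicator hzB
  have h1 := setIntegral_condExp hx hint hA
  have hint' : Integrable (fun ω => ∫ v in B, P (x t ω) v) μ :=
    (integrable_condExp (m := history x t)
      (f := (z t ⁻¹' B).indicator fun _ => (1 : ℝ))).congr (h.condProb t ht B hB)
  rw [setIntegral_congr_ae hA' ((h.condProb t ht B hB).mono fun ω hω _ => hω),
    setIntegral_indicator hzB, setIntegral_const, smul_eq_mul, mul_one] at h1
  simp only [hP.stateMeasure_apply _ hB]
  rw [← ofReal_integral_eq_lintegral_ofReal hint'.integrableOn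
    (Filter.Eventually.of_forall fun ω => integral_nonneg (hP.nonneg _)), h1, measureReal_def,
    ENNReal.ofReal_toReal (measure_ne_top _ _)]

theorem HasStateDensity.lintegral_mul_eq {Ω : Type*} {m₀ : MeasurableSpace Ω} {μ : Measure Ω}
    [IsProbabilityMeasure μ] {P : Vec d → Vec d → ℝ} {x z : ℕ → Ω → Vec d}
    (h : HasStateDensity μ P x z) (hP : SymmetricDensities P) {t : ℕ} (ht : 1 ≤ t)
    (hx : history x t ≤ m₀) {W : Ω → ENNReal}
    (hW : Measurable[history x t] W) {H : Vec d × Vec d → ENNReal} (hH : Measurable H) :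
    ∫⁻ ω, W ω * H (x t ω, z t ω) ∂μ =
      ∫⁻ ω, W ω * ∫⁻ v, H (x t ω, v) ∂stateMeasure P (x t ω) ∂μ := by
  have hxt : Measurable[history x t] (x t) :=
    Measurable.of_comap_le (le_iSup₂_of_le t ⟨ht, le_rfl⟩ le_rfl)
  have := hP.isMarkovKernel
  -- Here `X` is the identity from `Ω` to `Ω` with the σ-algebra of the past, so the sets `A` are
  -- the past events.
  have key := @lintegral_mul_eq_lintegral_kernel Ω Ω (Vec d) (Vec d) m₀ (history x t) inferInstance
    inferInstance μ inferInstance id (measurable_id'' hx) (z t) (h.measurable t ht) (x t) hxt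
    (stateKernel P) this
    (fun A hA B hB => by
      simp only [hP.stateKernel_apply, id]
      exact h.measure_inter hP ht hx hA hB) W hW H hH
  simpa only [hP.stateKernel_apply, id] using key

/-! ### Step sizes and growth of the gradient -/

theorem stepSize_pos {a : ℝ} (ha : 0 < a) (η : ℝ) (t : ℕ) : 0 < stepSize a η t := by
  unfold stepSize
  positivity

theorem stepSize_le {a η : ℝ} (ha : 0 < a) (hη : 0 ≤ η) (t : ℕ) : stepSize a η t ≤ a := by
  unfold stepSize
  exact div_le_self ha.le (Real.one_le_rpow (by linarith [t.cast_nonneg (α := ℝ)]) hη)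

/-- Bernoulli's inequality for `(1 - 1/(t+1))^(1-η)`. The right side telescopes when summed over
`t`. -/
theorem one_sub_mul_stepSize_le {a η : ℝ} (ha : 0 < a) (hη : η ∈ Set.Icc (0 : ℝ) 1) (t : ℕ) :
    (1 - η) * stepSize a η t ≤ a * (((t : ℝ) + 1) ^ (1 - η) - (t : ℝ) ^ (1 - η)) := by
  have hs : 0 < (t : ℝ) + 1 := by positivity
  have ht : (t : ℝ) = ((t : ℝ) + 1) * (1 + -1 / ((t : ℝ) + 1)) := by field_simp; ring
  have hb : -1 ≤ -1 / ((t : ℝ) + 1) := by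
    rw [le_div_iff₀ hs]
    linarith [t.cast_nonneg (α := ℝ)]
  have h1 := rpow_one_add_le_one_add_mul_self hb (sub_nonneg.2 hη.2)
    (by linarith [hη.1] : 1 - η ≤ 1)
  have h2 : (t : ℝ) ^ (1 - η) ≤
      ((t : ℝ) + 1) ^ (1 - η) * (1 + (1 - η) * (-1 / ((t : ℝ) + 1))) := by
    nth_rw 1 [ht]
    rw [Real.mul_rpow hs.le (by linarith)]
    gcongr
  have h3 : ((t : ℝ) + 1) ^ (1 - η) = ((t : ℝ) + 1) / ((t : ℝ) + 1) ^ η := by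
    rw [Real.rpow_sub hs, Real.rpow_one]
  have h4 : (1 - η) * (1 / ((t : ℝ) + 1) ^ η) ≤
      ((t : ℝ) + 1) ^ (1 - η) - (t : ℝ) ^ (1 - η) := by
    have : ((t : ℝ) + 1) ^ (1 - η) * (1 + (1 - η) * (-1 / ((t : ℝ) + 1))) =
        ((t : ℝ) + 1) ^ (1 - η) - (1 - η) * (1 / ((t : ℝ) + 1) ^ η) := by
      rw [h3]
      field_simp
      ring
    linarith
  calc (1 - η) * stepSize a η t = a * ((1 - η) * (1 / ((t : ℝ) + 1) ^ η)) := by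
        unfold stepSize; ring
    _ ≤ _ := by gcongr

theorem stepSize_sq {a η : ℝ} (t : ℕ) :
    stepSize a η t ^ 2 = a ^ 2 * ((t : ℝ) + 1) ^ (-2 * η) := by
  have : (0 : ℝ) ≤ (t : ℝ) + 1 := by positivity
  rw [stepSize, div_pow, ← Real.rpow_natCast, ← Real.rpow_natCast, ← Real.rpow_mul this,
    div_eq_mul_inv, ← Real.rpow_neg this]
  congr 2
  push_cast
  ring

theorem mul_rpow_le_sum_stepSize {a η : ℝ} (ha : 0 < a) (hη : η ∈ Set.Icc (0 : ℝ) 1) {t : ℕ}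
    (ht : 1 ≤ t) :
    a / 2 * (t : ℝ) ^ (1 - η) ≤ ∑ k ∈ Finset.Icc 1 t, stepSize a η k := by
  have ht1 : (1 : ℝ) ≤ t := by exact_mod_cast ht
  have ht0 : (0 : ℝ) < t := by linarith
  have h1 : ((t : ℝ) + 1) ^ η ≤ 2 * (t : ℝ) ^ η := by
    calc ((t : ℝ) + 1) ^ η ≤ (2 * t) ^ η :=
          Real.rpow_le_rpow (by positivity) (by linarith) hη.1
      _ = 2 ^ η * (t : ℝ) ^ η := Real.mul_rpow (by norm_num) ht0.le
      _ ≤ 2 * (t : ℝ) ^ η := by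
          gcongr
          simpa using Real.rpow_le_rpow_of_exponent_le (one_le_two (α := ℝ)) hη.2
  calc a / 2 * (t : ℝ) ^ (1 - η) = t * (a / (2 * (t : ℝ) ^ η)) := by
        rw [Real.rpow_sub ht0, Real.rpow_one]
        field_simp
    _ ≤ t * (a / ((t : ℝ) + 1) ^ η) := by gcongr
    _ = ∑ _k ∈ Finset.Icc 1 t, a / ((t : ℝ) + 1) ^ η := by simp
    _ ≤ _ := by
        refine Finset.sum_le_sum fun k hk => ?_
        have hkt : (k : ℝ) ≤ t := by exact_mod_cast (Finset.mem_Icc.1 hk).2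
        unfold stepSize
        gcongr
        exact hη.1

section Dynamics

variable {Ω Ξ : Type*} {Ψ : Vec d → Vec d} {f : Vec d → Ξ → ℝ} {ξ : ℕ → Ω → Ξ} {F : Vec d → ℝ}
  {x₁ : Vec d} {x : ℕ → Ω → Vec d} {C L a η : ℝ}

theorem stochGrad_eq (t : ℕ) (ω : Ω) :
    stochGrad f ξ x t ω = gradient F (x t ω) + noise F f ξ x t ω := by
  simp [noise]

/-- A step moves the iterate by at most `αC`, hence the gradient by at most `LαC`; the step sizes
are summed by `one_sub_mul_stepSize_le`. -/
theorem IsNSGD.norm_gradient_le (hx : IsNSGD Ψ f ξ (stepSize a η) x₁ x) (hF : SmoothCost F L)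
    (hL : 0 ≤ L) (hC0 : 0 ≤ C) (hC : ∀ v, ‖Ψ v‖ ≤ C) (ha : 0 < a) (hη : η ∈ Set.Icc (0 : ℝ) 1)
    {t : ℕ} (ht : 1 ≤ t) (ω : Ω) :
    (1 - η) * ‖gradient F (x t ω)‖ ≤
      (1 - η) * ‖gradient F x₁‖ + L * C * a * (t : ℝ) ^ (1 - η) := by
  have h1η : 0 ≤ 1 - η := sub_nonneg.2 hη.2
  induction t, ht using Nat.le_induction with
  | base =>
    rw [hx.init]
    have : 0 ≤ L * C * a * ((1 : ℕ) : ℝ) ^ (1 - η) := by positivity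
    linarith
  | succ t ht ih =>
    have h1 : ‖gradient F (x (t + 1) ω)‖ ≤ ‖gradient F (x t ω)‖ + L * (stepSize a η t * C) := by
      have h2 := norm_le_norm_add_norm_sub' (gradient F (x (t + 1) ω)) (gradient F (x t ω))
      have h3 := hF.lipschitz (x (t + 1) ω) (x t ω)
      have h4 : ‖x (t + 1) ω - x t ω‖ ≤ stepSize a η t * C := by
        rw [hx.step t ht, sub_sub_cancel_left, norm_neg, norm_smul,
          Real.norm_of_nonneg (stepSize_pos ha η t).le]
        exact mul_le_mul_of_nonneg_left (hC _) (stepSize_pos ha η t).le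
      have h5 := mul_le_mul_of_nonneg_left h4 hL
      linarith
    have h2 := mul_le_mul_of_nonneg_left h1 h1η
    have h3 := mul_le_mul_of_nonneg_left (one_sub_mul_stepSize_le ha hη t) (mul_nonneg hL hC0)
    push_cast
    linarith

variable [MeasurableSpace Ω]

theorem IsNSGD.measurable {α : ℕ → ℝ} (hx : IsNSGD Ψ f ξ α x₁ x) (hΨ : Measurable Ψ)
    (hF : SmoothCost F L) (hz : ∀ t, 1 ≤ t → Measurable (noise F f ξ x t)) {t : ℕ} (ht : 1 ≤ t) :
    Measurable (x t) := by
  induction t, ht using Nat.le_induction with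
  | base => exact (funext hx.init : x 1 = fun _ => x₁) ▸ measurable_const
  | succ t ht ih =>
    have h : x (t + 1) = fun ω =>
        x t ω - α t • Ψ (gradient F (x t ω) + noise F f ξ x t ω) := by
      funext ω
      rw [hx.step t ht, stochGrad_eq (F := F)]
    rw [h]
    have := hF.continuous_gradient.measurable.comp ih
    have := hz t ht
    exact ih.sub ((hΨ.comp (Measurable.add ‹_› this)).const_smul (α t))

end Dynamics

theorem measurable_history {Ω : Type*} {x : ℕ → Ω → Vec d} {k t : ℕ} (hk : k ∈ Set.Icc 1 t) :
    Measurable[history x t] (x k) :=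
  Measurable.of_comap_le (le_iSup₂_of_le k hk le_rfl)

theorem history_le {Ω : Type*} {m : MeasurableSpace Ω} {x : ℕ → Ω → Vec d}
    (hx : ∀ t, 1 ≤ t → Measurable (x t)) (t : ℕ) : history x t ≤ m :=
  iSup₂_le fun s hs => (hx s hs.1).comap_le

/-! ### The exponential supermartingale -/

/-- The guaranteed decrease `min {β₁‖∇F(u)‖, β₂‖∇F(u)‖²}` at the point `u`. -/
def decrease (F : Vec d → ℝ) (β₁ β₂ : ℝ) (u : Vec d) : ℝ :=
  min (β₁ * ‖gradient F u‖) (β₂ * ‖gradient F u‖ ^ 2)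

theorem SmoothCost.continuous_decrease {F : Vec d → ℝ} {L : ℝ} (hF : SmoothCost F L)
    (β₁ β₂ : ℝ) : Continuous (decrease F β₁ β₂) := by
  have := hF.continuous_gradient
  unfold decrease
  fun_prop

/-- The exponent of the supermartingale that controls nonlinear SGD. -/
def potential {Ω : Type*} (F : Vec d → ℝ) (x₁ : Vec d) (β₁ β₂ c : ℝ) (α : ℕ → ℝ)
    (x : ℕ → Ω → Vec d) (t : ℕ) (ω : Ω) : ℝ :=
  ∑ k ∈ Finset.Icc 1 t, (α k / 2 * decrease F β₁ β₂ (x k ω) - c * α k ^ 2) +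
    (F (x (t + 1) ω) - F x₁)

/-- One conditional step: the exponential moment of the decrease minus the noisy progress. -/
theorem lintegral_exp_step_le_one {Ψ : Vec d → Vec d} {P : Vec d → Vec d → ℝ} {β₁ β₂ C α : ℝ}
    (hP : SymmetricDensities P) (hΨ : Measurable Ψ) (hC0 : 0 ≤ C) (hC : ∀ v, ‖Ψ v‖ ≤ C)
    (hβ : DenoisingConstants Ψ P β₁ β₂) (hα : 0 ≤ α) (F : Vec d → ℝ) (u : Vec d)
    (h₁ : α * C ^ 2 * ‖gradient F u‖ ≤ β₁) (h₂ : α * C ^ 2 ≤ β₂) :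
    ∫⁻ v, ENNReal.ofReal (Real.exp (α / 2 * decrease F β₁ β₂ u -
      α * inner ℝ (Ψ (gradient F u + v)) (gradient F u))) ∂stateMeasure P u ≤ 1 := by
  have hmeas : Measurable fun v => inner ℝ (Ψ (gradient F u + v)) (gradient F u) :=
    (hΨ.comp (measurable_const_add _)).inner measurable_const
  have e : ∀ v, ENNReal.ofReal (Real.exp (α / 2 * decrease F β₁ β₂ u -
      α * inner ℝ (Ψ (gradient F u + v)) (gradient F u))) =
      ENNReal.ofReal (Real.exp (α / 2 * decrease F β₁ β₂ u)) *
        ENNReal.ofReal (Real.exp (-α * inner ℝ (Ψ (gradient F u + v)) (gradient F u))) := by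
    intro v
    rw [← ENNReal.ofReal_mul (Real.exp_nonneg _), ← Real.exp_add]
    congr 2
    ring
  simp only [e]
  rw [lintegral_const_mul _ (by fun_prop)]
  refine (mul_le_mul_right (hP.lintegral_exp_inner_le hΨ hC0 hC u (gradient F u) α) _).trans ?_
  rw [← ENNReal.ofReal_mul (Real.exp_nonneg _), ← Real.exp_add]
  refine ENNReal.ofReal_le_one.2 (Real.exp_le_one_iff.2 ?_)
  -- Thus the Hoeffding term `α²C²‖g‖²/2` uses up half of the guaranteed drift; the other half
  -- cancels `α/2 * decrease`.
  have hmin : α * C ^ 2 * ‖gradient F u‖ ^ 2 ≤ decrease F β₁ β₂ u := by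
    refine le_min ?_ ?_
    · have := mul_le_mul_of_nonneg_right h₁ (norm_nonneg (gradient F u))
      linarith
    · exact mul_le_mul_of_nonneg_right h₂ (sq_nonneg _)
  have hden := mul_le_mul_of_nonneg_left (hβ.2.2 u (gradient F u)) hα
  have h3 := mul_le_mul_of_nonneg_left hmin hα
  have : decrease F β₁ β₂ u = min (β₁ * ‖gradient F u‖) (β₂ * ‖gradient F u‖ ^ 2) := rfl
  rw [← this] at hden
  linarith

section Supermartingale

variable {Ω Ξ : Type*}
  {Ψ : Vec d → Vec d} {P : Vec d → Vec d → ℝ} {f : Vec d → Ξ → ℝ} {ξ : ℕ → Ω → Ξ} {F : Vec d → ℝ}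
  {x₁ : Vec d} {x : ℕ → Ω → Vec d} {C L β₁ β₂ : ℝ} {α : ℕ → ℝ}

theorem measurable_potential (hF : SmoothCost F L) (c : ℝ) (t : ℕ) (m : MeasurableSpace Ω)
    (hx : ∀ k ∈ Set.Icc 1 (t + 1), Measurable[m] (x k)) :
    Measurable[m] (potential F x₁ β₁ β₂ c α x t) := by
  unfold potential
  refine Measurable.add (Finset.measurable_fun_sum _ fun k hk => ?_) ?_
  · have := (hF.continuous_decrease β₁ β₂).measurable.comp
      (hx k ⟨(Finset.mem_Icc.1 hk).1, (Finset.mem_Icc.1 hk).2.trans t.le_succ⟩)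
    exact (this.const_mul _).sub measurable_const
  · exact (hF.differentiable.continuous.measurable.comp (hx (t + 1) ⟨by omega, le_rfl⟩)).sub
      measurable_const

/-- The descent lemma along one step; the curvature term `Lα²‖Ψ‖²` is paid for by the compensator
`LC²α²`. -/
theorem potential_succ_le (hx : IsNSGD Ψ f ξ α x₁ x) (hF : SmoothCost F L) (hL : 0 ≤ L)
    (hC : ∀ v, ‖Ψ v‖ ≤ C) (t : ℕ) (ω : Ω) :
    potential F x₁ β₁ β₂ (L * C ^ 2) α x (t + 1) ω ≤
      potential F x₁ β₁ β₂ (L * C ^ 2) α x t ω +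
        (α (t + 1) / 2 * decrease F β₁ β₂ (x (t + 1) ω) -
          α (t + 1) * inner ℝ (Ψ (gradient F (x (t + 1) ω) + noise F f ξ x (t + 1) ω))
            (gradient F (x (t + 1) ω))) := by
  unfold potential
  rw [Finset.sum_Icc_succ_top (by omega)]
  have h1 := hF.le_add_inner_add hL (x (t + 1) ω) (x (t + 1 + 1) ω)
  rw [hx.step (t + 1) (by omega), stochGrad_eq (F := F), sub_sub_cancel_left, norm_neg, norm_smul,
    inner_neg_right, inner_smul_right, real_inner_comm, mul_pow, Real.norm_eq_abs, sq_abs] at h1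
  have h2 : ‖Ψ (gradient F (x (t + 1) ω) + noise F f ξ x (t + 1) ω)‖ ^ 2 ≤ C ^ 2 := by
    gcongr
    exact hC _
  have h3 := mul_le_mul_of_nonneg_left h2 (mul_nonneg hL (sq_nonneg (α (t + 1))))
  rw [hx.step (t + 1) (by omega), stochGrad_eq (F := F)]
  linarith

variable [MeasurableSpace Ω] {μ : Measure Ω} [IsProbabilityMeasure μ]

theorem lintegral_exp_potential_le_one (hP : SymmetricDensities P) (hΨ : Measurable Ψ)
    (hC0 : 0 ≤ C) (hC : ∀ v, ‖Ψ v‖ ≤ C) (hβ : DenoisingConstants Ψ P β₁ β₂)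
    (hF : SmoothCost F L) (hL : 0 ≤ L) (hx : IsNSGD Ψ f ξ α x₁ x)
    (hz : HasStateDensity μ P x (noise F f ξ x)) (hα : ∀ t, 0 ≤ α t)
    (h₁ : ∀ t, 1 ≤ t → ∀ ω, α t * C ^ 2 * ‖gradient F (x t ω)‖ ≤ β₁)
    (h₂ : ∀ t, 1 ≤ t → α t * C ^ 2 ≤ β₂) (t : ℕ) :
    ∫⁻ ω, ENNReal.ofReal (Real.exp (potential F x₁ β₁ β₂ (L * C ^ 2) α x t ω)) ∂μ ≤ 1 := by
  induction t with
  | zero => simp [potential, hx.init]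
  | succ t ih =>
    have hxm : ∀ k, 1 ≤ k → Measurable (x k) := fun k hk => hx.measurable hΨ hF hz.measurable hk
    let H : Vec d × Vec d → ENNReal := fun p =>
      ENNReal.ofReal (Real.exp (α (t + 1) / 2 * decrease F β₁ β₂ p.1 -
        α (t + 1) * inner ℝ (Ψ (gradient F p.1 + p.2)) (gradient F p.1)))
    have hH : Measurable H := by
      have h1 := (hF.continuous_decrease β₁ β₂).measurable
      have h2 := hF.continuous_gradient.measurable
      have h3 : Measurable fun p : Vec d × Vec d =>
          inner ℝ (Ψ (gradient F p.1 + p.2)) (gradient F p.1) := by fun_prop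
      fun_prop
    -- The potential at `t` involves the iterates only up to `t + 1`, so it is known before the
    -- noise at `t + 1` is drawn.
    have hW : Measurable[history x (t + 1)] fun ω =>
        ENNReal.ofReal (Real.exp (potential F x₁ β₁ β₂ (L * C ^ 2) α x t ω)) :=
      (Real.measurable_exp.comp (measurable_potential hF _ t _
        fun k hk => measurable_history hk)).ennreal_ofReal
    calc _ ≤ ∫⁻ ω, ENNReal.ofReal (Real.exp (potential F x₁ β₁ β₂ (L * C ^ 2) α x t ω)) *
          H (x (t + 1) ω, noise F f ξ x (t + 1) ω) ∂μ := by
          refine lintegral_mono fun ω => ?_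
          rw [← ENNReal.ofReal_mul (Real.exp_nonneg _), ← Real.exp_add]
          gcongr
          exact potential_succ_le hx hF hL hC t ω
      _ = ∫⁻ ω, ENNReal.ofReal (Real.exp (potential F x₁ β₁ β₂ (L * C ^ 2) α x t ω)) *
          ∫⁻ v, H (x (t + 1) ω, v) ∂stateMeasure P (x (t + 1) ω) ∂μ :=
          hz.lintegral_mul_eq hP (by omega) (history_le hxm _) hW hH
      _ ≤ ∫⁻ ω, ENNReal.ofReal (Real.exp (potential F x₁ β₁ β₂ (L * C ^ 2) α x t ω)) * 1 ∂μ := by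
          gcongr with ω
          exact lintegral_exp_step_le_one hP hΨ hC0 hC hβ (hα _) F _
            (h₁ (t + 1) (by omega) ω) (h₂ (t + 1) (by omega))
      _ ≤ 1 := by simpa using ih

/-- The high-probability bound on the potential. -/
theorem le_measure_potential_lt (hP : SymmetricDensities P) (hΨ : Measurable Ψ)
    (hC0 : 0 ≤ C) (hC : ∀ v, ‖Ψ v‖ ≤ C) (hβ : DenoisingConstants Ψ P β₁ β₂)
    (hF : SmoothCost F L) (hL : 0 ≤ L) (hx : IsNSGD Ψ f ξ α x₁ x)
    (hz : HasStateDensity μ P x (noise F f ξ x)) (hα : ∀ t, 0 ≤ α t)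
    (h₁ : ∀ t, 1 ≤ t → ∀ ω, α t * C ^ 2 * ‖gradient F (x t ω)‖ ≤ β₁)
    (h₂ : ∀ t, 1 ≤ t → α t * C ^ 2 ≤ β₂) (t : ℕ) {δ : ℝ} (hδ : 0 < δ) :
    ENNReal.ofReal (1 - δ) ≤
      μ {ω | potential F x₁ β₁ β₂ (L * C ^ 2) α x t ω < Real.log (1 / δ)} := by
  have hm : Measurable (potential F x₁ β₁ β₂ (L * C ^ 2) α x t) :=
    measurable_potential hF _ t _ fun k hk => hx.measurable hΨ hF hz.measurable hk.1
  have hexp : Measurable fun ω =>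
      ENNReal.ofReal (Real.exp (potential F x₁ β₁ β₂ (L * C ^ 2) α x t ω)) :=
    (Real.measurable_exp.comp hm).ennreal_ofReal
  -- Markov's inequality for the exponential of the potential at level `1/δ`.
  have hmarkov : μ {ω | Real.log (1 / δ) ≤ potential F x₁ β₁ β₂ (L * C ^ 2) α x t ω} ≤
      ENNReal.ofReal δ := by
    have h := meas_ge_le_lintegral_div (μ := μ) hexp.aemeasurable
      (ε := ENNReal.ofReal (1 / δ)) (by simpa using hδ) ENNReal.ofReal_ne_top
    refine (measure_mono fun ω hω => ?_).trans (h.trans ?_)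
    · refine ENNReal.ofReal_le_ofReal ?_
      rw [← Real.exp_log (one_div_pos.2 hδ)]
      exact Real.exp_le_exp.2 hω
    · refine (ENNReal.div_le_div_right (lintegral_exp_potential_le_one hP hΨ hC0 hC hβ hF hL hx hz
        hα h₁ h₂ t) _).trans ?_
      rw [one_div, one_div, ENNReal.ofReal_inv_of_pos hδ, inv_inv]
  have hcompl : {ω | potential F x₁ β₁ β₂ (L * C ^ 2) α x t ω < Real.log (1 / δ)} =
      {ω | Real.log (1 / δ) ≤ potential F x₁ β₁ β₂ (L * C ^ 2) α x t ω}ᶜ := by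
    ext ω
    simp
  rw [hcompl, prob_compl_eq_one_sub (measurableSet_le measurable_const hm),
    ENNReal.ofReal_sub _ hδ.le, ENNReal.ofReal_one]
  exact tsub_le_tsub_left hmarkov 1

end Supermartingale

/-! ### From the potential to the smallest gradient -/

/-- From a bound on the weighted sum of the decreases to a bound on the smallest gradient. -/
theorem minSqGrad_le {Ω : Type*} {F : Vec d → ℝ} {x₁ : Vec d} {x : ℕ → Ω → Vec d}
    {β₁ β₂ a η c : ℝ} (hβ₁ : 0 < β₁) (hβ₂ : 0 < β₂) (ha : 0 < a) (hη : η ∈ Set.Icc (0 : ℝ) 1)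
    (hc : 0 ≤ c) (hF : BddBelow (Set.range F)) {t : ℕ} (ht : 1 ≤ t) {l : ℝ} (hl : 0 ≤ l) {ω : Ω}
    (hx : x 1 ω = x₁) (h : potential F x₁ β₁ β₂ c (stepSize a η) x t ω ≤ l) :
    minSqGrad F x t ht ω ≤
      4 * (1 + 4 * |F x₁ - ⨅ v, F v| + c * a ^ 2) / a * (1 / β₂ + |‖gradient F x₁‖| / β₁) *
        ((t : ℝ) ^ (η - 1) * (l + ∑ k ∈ Finset.Icc 1 t, ((k : ℝ) + 1) ^ (-2 * η))) := by
  set s := minSqGrad F x t ht ω with hs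
  set V := ∑ k ∈ Finset.Icc 1 t, ((k : ℝ) + 1) ^ (-2 * η) with hV
  set Δ := F x₁ - ⨅ v, F v with hΔ
  have ht0 : (0 : ℝ) < t := by exact_mod_cast ht
  have hΔ0 : 0 ≤ Δ := sub_nonneg.2 (ciInf_le hF x₁)
  have hs0 : 0 ≤ s := (Finset.le_inf'_iff _ _).2 fun k _ => sq_nonneg _
  have hsk : ∀ k ∈ Finset.Icc 1 t, s ≤ ‖gradient F (x k ω)‖ ^ 2 := fun k hk =>
    Finset.inf'_le (fun k => ‖gradient F (x k ω)‖ ^ 2) hk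
  have hsG : √s ≤ ‖gradient F x₁‖ := by
    rw [Real.sqrt_le_left (norm_nonneg _), ← hx]
    exact hsk 1 (Finset.mem_Icc.2 ⟨le_rfl, ht⟩)
  set ρ := min (β₁ * √s) (β₂ * s) with hρ
  have hρ0 : 0 ≤ ρ := le_min (by positivity) (by positivity)
  have hρk : ∀ k ∈ Finset.Icc 1 t, ρ ≤ decrease F β₁ β₂ (x k ω) := by
    intro k hk
    have h1 := hsk k hk
    have h2 : √s ≤ ‖gradient F (x k ω)‖ := (Real.sqrt_le_left (norm_nonneg _)).2 h1
    exact min_le_min (by gcongr) (by gcongr)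
  -- The term `k = 1` is at least `1/4`, which allows the constant `Δ` to be absorbed into `4ΔV`.
  have hV1 : 1 ≤ 4 * V := by
    have h1 : (2 : ℝ) ^ (-2 * η) ≤ V := by
      refine le_trans (le_of_eq ?_)
        (Finset.single_le_sum (f := fun k : ℕ => ((k : ℝ) + 1) ^ (-2 * η))
          (fun k _ => by positivity) (Finset.mem_Icc.2 ⟨le_rfl, ht⟩))
      rw [Nat.cast_one, one_add_one_eq_two]
    have h2 : (2 : ℝ) ^ (-2 : ℝ) ≤ (2 : ℝ) ^ (-2 * η) :=
      Real.rpow_le_rpow_of_exponent_le one_le_two (by linarith [hη.2])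
    have h3 : (2 : ℝ) ^ (-2 : ℝ) = 1 / 4 := by
      rw [Real.rpow_neg (by norm_num)]
      norm_num
    rw [h3] at h2
    linarith
  have hsum : ∑ k ∈ Finset.Icc 1 t, stepSize a η k / 2 * decrease F β₁ β₂ (x k ω) ≤
      l + Δ + c * a ^ 2 * V := by
    have h1 : ∑ k ∈ Finset.Icc 1 t, c * stepSize a η k ^ 2 = c * a ^ 2 * V := by
      rw [hV, Finset.mul_sum]
      refine Finset.sum_congr rfl fun k _ => ?_
      rw [stepSize_sq, mul_assoc]
    rw [potential, Finset.sum_sub_distrib, h1] at h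
    have := ciInf_le hF (x (t + 1) ω)
    linarith
  have hlow : a / 4 * (t : ℝ) ^ (1 - η) * ρ ≤
      ∑ k ∈ Finset.Icc 1 t, stepSize a η k / 2 * decrease F β₁ β₂ (x k ω) := by
    calc a / 4 * (t : ℝ) ^ (1 - η) * ρ = (a / 2 * (t : ℝ) ^ (1 - η)) * (ρ / 2) := by ring
      _ ≤ (∑ k ∈ Finset.Icc 1 t, stepSize a η k) * (ρ / 2) := by
          gcongr
          exact mul_rpow_le_sum_stepSize ha hη ht
      _ = ∑ k ∈ Finset.Icc 1 t, stepSize a η k / 2 * ρ := by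
          rw [Finset.sum_mul]
          exact Finset.sum_congr rfl fun k _ => by ring
      _ ≤ _ := Finset.sum_le_sum fun k hk =>
          mul_le_mul_of_nonneg_left (hρk k hk) (half_pos (stepSize_pos ha η k)).le
  set A := 1 + 4 * |Δ| + c * a ^ 2 with hA
  have hA0 : 0 < A := by positivity
  set r := l + V with hr
  have hr0 : 0 ≤ r := by linarith
  have hAr : l + Δ + c * a ^ 2 * V ≤ A * r := by
    rw [hA, hr, abs_of_nonneg hΔ0]
    have h1 := mul_nonneg hΔ0 hl
    have h2 := mul_nonneg (mul_nonneg hc (sq_nonneg a)) hl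
    have h3 := mul_le_mul_of_nonneg_left hV1 hΔ0
    nlinarith
  have hρle : ρ ≤ 4 * A / a * ((t : ℝ) ^ (η - 1) * r) := by
    have h1 : (t : ℝ) ^ (1 - η) * (t : ℝ) ^ (η - 1) = 1 := by
      rw [← Real.rpow_add ht0]
      simp
    have h2 : 0 ≤ 4 / a * (t : ℝ) ^ (η - 1) := by positivity
    calc ρ = 4 / a * (t : ℝ) ^ (η - 1) * (a / 4 * (t : ℝ) ^ (1 - η) * ρ) := by
          field_simp
          linear_combination (-ρ) * h1
      _ ≤ 4 / a * (t : ℝ) ^ (η - 1) * (A * r) :=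
          mul_le_mul_of_nonneg_left ((hlow.trans hsum).trans hAr) h2
      _ = _ := by ring
  -- In the linear branch of the minimum, `s = √s · √s` and one factor is bounded by the initial
  -- gradient norm. This keeps the bound linear in `ρ`.
  have hfin : s ≤ (1 / β₂ + |‖gradient F x₁‖| / β₁) * ρ := by
    rw [abs_norm]
    rcases min_cases (β₁ * √s) (β₂ * s) with ⟨h1, -⟩ | ⟨h1, -⟩
    · calc s = √s * √s := (Real.mul_self_sqrt hs0).symm
        _ ≤ ‖gradient F x₁‖ * √s := by gcongr
        _ = ‖gradient F x₁‖ / β₁ * ρ := by rw [hρ, h1]; field_simp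
        _ ≤ _ := by
            gcongr
            exact le_add_of_nonneg_left (by positivity)
    · calc s = 1 / β₂ * ρ := by rw [hρ, h1]; field_simp
        _ ≤ _ := by
            gcongr
            exact le_add_of_nonneg_right (by positivity)
  calc s ≤ (1 / β₂ + |‖gradient F x₁‖| / β₁) * ρ := hfin
    _ ≤ (1 / β₂ + |‖gradient F x₁‖| / β₁) * (4 * A / a * ((t : ℝ) ^ (η - 1) * r)) := by gcongr
    _ = _ := by ring

/-- The step-size condition keeps the effective step below the guaranteed decrease. -/
theorem IsNSGD.stepSize_mul_norm_gradient_le {Ω Ξ : Type*} {Ψ : Vec d → Vec d}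
    {f : Vec d → Ξ → ℝ} {ξ : ℕ → Ω → Ξ} {F : Vec d → ℝ} {x₁ : Vec d} {x : ℕ → Ω → Vec d}
    {C L a η β₁ : ℝ}
    (hx : IsNSGD Ψ f ξ (stepSize a η) x₁ x) (hF : SmoothCost F L)
    (hL : 0 ≤ L) (hC0 : 0 ≤ C) (hC : ∀ v, ‖Ψ v‖ ≤ C) (ha : 0 < a) (ha1 : a ≤ 1)
    (hη : η ∈ Set.Ico (1 / 2 : ℝ) 1)
    (hβ : a * (C ^ 2 * (L * C + (1 - η) * ‖gradient F x₁‖)) ≤ (1 - η) * β₁)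
    {t : ℕ} (ht : 1 ≤ t) (ω : Ω) :
    stepSize a η t * C ^ 2 * ‖gradient F (x t ω)‖ ≤ β₁ := by
  have h1η : 0 < 1 - η := sub_pos.2 hη.2
  have hη' : η ∈ Set.Icc (0 : ℝ) 1 := ⟨by linarith [hη.1], hη.2.le⟩
  have ht0 : (0 : ℝ) < t := by exact_mod_cast ht
  have ht1 : (1 : ℝ) ≤ t := by exact_mod_cast ht
  have hg := hx.norm_gradient_le hF hL hC0 hC ha hη' ht ω
  have hs0 := (stepSize_pos ha η t).le
  have hsa := stepSize_le ha hη'.1 t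
  -- Here `η ≥ 1/2` enters, through `t^(1-η) ≤ t^η`: the step size compensates the growth of the
  -- gradient.
  have hst : stepSize a η t * (t : ℝ) ^ (1 - η) ≤ a := by
    have h1 : (t : ℝ) ^ (1 - η) ≤ ((t : ℝ) + 1) ^ η :=
      calc (t : ℝ) ^ (1 - η) ≤ (t : ℝ) ^ η :=
            Real.rpow_le_rpow_of_exponent_le ht1 (by linarith [hη.1])
        _ ≤ _ := Real.rpow_le_rpow ht0.le (by linarith) hη'.1
    unfold stepSize
    rw [div_mul_eq_mul_div]
    exact div_le_of_le_mul₀ (by positivity) ha.le (by gcongr)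
  refine le_of_mul_le_mul_left ?_ h1η
  calc (1 - η) * (stepSize a η t * C ^ 2 * ‖gradient F (x t ω)‖)
      = stepSize a η t * C ^ 2 * ((1 - η) * ‖gradient F (x t ω)‖) := by ring
    _ ≤ stepSize a η t * C ^ 2 *
        ((1 - η) * ‖gradient F x₁‖ + L * C * a * (t : ℝ) ^ (1 - η)) := by gcongr
    _ = C ^ 2 * (stepSize a η t * ((1 - η) * ‖gradient F x₁‖) +
        L * C * (a * (stepSize a η t * (t : ℝ) ^ (1 - η)))) := by ring
    -- The condition `a ≤ 1` replaces `a * a` by `1 * a`, so that the requirement is linear in `a`.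
    _ ≤ C ^ 2 * (a * ((1 - η) * ‖gradient F x₁‖) + L * C * (1 * a)) := by gcongr
    _ = a * (C ^ 2 * (L * C + (1 - η) * ‖gradient F x₁‖)) := by ring
    _ ≤ _ := hβ

end NSGD

end

theorem corollary1 {d : ℕ} (Ψ : NSGD.Vec d → NSGD.Vec d)
    (P : NSGD.Vec d → NSGD.Vec d → ℝ)
    (hΨ : NSGD.IsComponentwise Ψ ∨ NSGD.IsJoint Ψ)
    (hP : NSGD.SymmetricDensities P)
    (hd : d = 1 → ¬ NSGD.IsComponentwise Ψ → NSGD.UniformlyPositiveOnBall P) :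
    (∃ β₁ β₂ : ℝ, NSGD.DenoisingConstants Ψ P β₁ β₂) ∧
    ∀ β₁ β₂ : ℝ, NSGD.DenoisingConstants Ψ P β₁ β₂ →
    ∀ C : ℝ, 0 < C → (∀ v, ‖Ψ v‖ ≤ C) →
    ∀ L Δ G a η : ℝ, 0 ≤ L → η ∈ Set.Ico (1 / 2 : ℝ) 1 →
      0 < a → a ≤ 1 → a * (8 * C ^ 2) ≤ β₂ →
      a * (8 * C ^ 2 * (L * C + (1 - η) * G)) ≤ (1 - η) * β₁ →
    ∃ M : ℝ, 0 < M ∧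
      ∀ (F : NSGD.Vec d → ℝ) (x₁ : NSGD.Vec d),
        NSGD.SmoothCost F L → F x₁ - (⨅ v, F v) = Δ → ‖gradient F x₁‖ = G →
      ∀ {Ω Ξ : Type*} [MeasurableSpace Ω] (μ : MeasureTheory.Measure Ω)
        [MeasureTheory.IsProbabilityMeasure μ]
        (f : NSGD.Vec d → Ξ → ℝ) (ξ : ℕ → Ω → Ξ) (x : ℕ → Ω → NSGD.Vec d),
        NSGD.IsNSGD Ψ f ξ (NSGD.stepSize a η) x₁ x →
        NSGD.HasStateDensity μ P x (NSGD.noise F f ξ x) →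
      ∀ (t : ℕ) (ht : 1 ≤ t) (δ : ℝ), δ ∈ Set.Ioo (0 : ℝ) 1 →
        ENNReal.ofReal (1 - δ) ≤
          μ {ω | NSGD.minSqGrad F x t ht ω ≤
            M * ((t : ℝ) ^ (η - 1) *
              (Real.log (1 / δ) + ∑ k ∈ Finset.Icc 1 t, ((k : ℝ) + 1) ^ (-2 * η)))} := by
  refine ⟨NSGD.exists_denoisingConstants hΨ hP hd, ?_⟩
  intro β₁ β₂ hβ C hC0 hC L Δ G a η hL hη ha ha1 hβ₂ hβ₁
  have hβ₁0 := hβ.1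
  have hβ₂0 := hβ.2.1
  have hη' : η ∈ Set.Icc (0 : ℝ) 1 := ⟨by linarith [hη.1], hη.2.le⟩
  -- The constant of `minSqGrad_le` with `c = LC²`. It is fixed before `F`, so absolute values
  -- ensure positivity for arbitrary reals `Δ` and `G`.
  refine ⟨4 * (1 + 4 * |Δ| + L * C ^ 2 * a ^ 2) / a * (1 / β₂ + |G| / β₁), by positivity, ?_⟩
  rintro F x₁ hF rfl rfl Ω Ξ _ μ _ f ξ x hx hz t ht δ hδ
  have hΨm : Measurable Ψ := hΨ.elim (fun h => h.measurable) fun h => h.measurable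
  have hl : 0 ≤ Real.log (1 / δ) := Real.log_nonneg (one_le_one_div hδ.1 hδ.2.le)
  -- Nonnegativity allows the factor `8` in the step-size condition to be dropped.
  have hpos : 0 ≤ a * (C ^ 2 * (L * C + (1 - η) * ‖gradient F x₁‖)) := by
    have := sub_pos.2 hη.2
    positivity
  refine (NSGD.le_measure_potential_lt hP hΨm hC0.le hC hβ hF hL hx hz
    (fun t => (NSGD.stepSize_pos ha η t).le)
    (fun t ht ω => hx.stepSize_mul_norm_gradient_le hF hL hC0.le hC ha ha1 hη
      (by linarith) ht ω)
    (fun t _ => ?_) t hδ.1).trans (MeasureTheory.measure_mono fun ω hω => ?_)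
  · have := mul_le_mul_of_nonneg_right (NSGD.stepSize_le ha hη'.1 t) (sq_nonneg C)
    have := mul_nonneg ha.le (sq_nonneg C)
    linarith
  · exact NSGD.minSqGrad_le hβ₁0 hβ₂0 ha hη' (by positivity) hF.bddBelow ht hl (hx.init ω)
      (le_of_lt hω)
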